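/- Graphs here are undirected with a self loop at each vertex (a set with a reflexive symmetric adjacency relation), and a graph homomorphism is a map of vertices preserving adjacency. For a graph $\Gamma$ let $A\Gamma=\langle v\in\Gamma \mid vw=wv \text{ whenever } v,w \text{ are adjacent}\rangle$ be its right-angled Artin group, and for a group $G$ let $CG$ be the commutation graph, whose vertices are the elements of $G$, with $g,h$ adjacent iff $gh=hg$. The functors $A\dashv C$ form an adjunction between graphs and groups, with unit $\eta_\Gamma:\Gamma\to CA\Gamma$, $v\mapsto v$. Thus $AC$ is a comonad on groups: $ACG$ is generated by symbols $[g]$, $g\in G$, with $[g][h]=[h][g]$ whenever $gh=hg$; the counit is $\epsilon_G:[g]\mapsto g$ and the comultiplication is $\delta_G:[g]\mapsto[[g]]$. An $AC$-coalgebra is a group $G$ with a homomorphism $\mathfrak g:G\to ACG$ such that $\epsilon_G\circ\mathfrak g=1_G$ and $AC(\mathfrak g)\circ\mathfrak g=\delta_G\circ\mathfrak g$; an isomorphism of coalgebras is a group isomorphism compatible with the structure maps. A graph presenting $(G,\mathfrak g)$ is a graph $\Gamma$ together with an isomorphism of coalgebras $\alpha:(A\Gamma,A\eta_\Gamma)\cong(G,\mathfrak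 g)$. **Theorem.** There is an algorithm (a partial recursive function) which takes as input a finite description of a homomorphism $f:G\to H$ between finitely presented groups carrying $AC$-coalgebra structures $\mathfrak g:G\to ACG$ and $\mathfrak h:H\to ACH$, namely: finite presentations of $G$ and $H$; for each generator $x$ of $G$, a word in the symbols $[w]^{\pm1}$, with each $w$ a word in the generators of $G$, representing $\mathfrak g(x)$; likewise for $\mathfrak h$; and, for each generator $x$ of $G$, a word in the generators of $H$ representing $f(x)$. On every such input the algorithm halts and decides whether $f$ is $A\varphi$ for a graph homomorphism $\varphi$ of the graphs presenting $G$ and $H$. That is: graphs presenting $(G,\mathfrak g)$ and $(H,\mathfrak h)$ exist, and for all such graphs $(\Gamma,\alpha)$ and $(\Delta,\beta)$ the answer is "yes" if and only if there is a graph homomorphism $\varphi:\Gamma\to\Delta$ with $f\circ\alpha=\beta\circ A\varphi$. -/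

import Mathlib

open CategoryTheory
open scoped commutatorElement

universe u

/-! ### Reflexive graphs, right-angled Artin groups, commutation graphs -/

/-- A graph: a symmetric adjacency relation with a self loop at each vertex. -/
structure Gph : Type (u + 1) where
  V : Type u
  Adj : V → V → Prop
  symm : ∀ v w, Adj v w → Adj w v
  refl : ∀ v, Adj v v

namespace Gph

/-- A graph homomorphism: a map on vertices that preserves adjacency. Because of the self loops,
an edge may be collapsed to a vertex. -/
@[ext]
structure Hom (Γ Δ : Gph.{u}) : Type u where
  toFun : Γ.V → Δ.V
  map_adj : ∀ v w, Γ.Adj v w → Δ.Adj (toFun v) (toFun w)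

instance : Category Gph.{u} where
  Hom := Hom
  id Γ := ⟨id, fun _ _ h => h⟩
  comp φ ψ := ⟨ψ.toFun ∘ φ.toFun, fun _ _ h => ψ.map_adj _ _ (φ.map_adj _ _ h)⟩

end Gph

/-- The defining relators of the right-angled Artin group of `Γ`: the commutators of adjacent
vertices. -/
def raagRels (Γ : Gph.{u}) : Set (FreeGroup Γ.V) :=
  {r | ∃ v w, Γ.Adj v w ∧ r = ⁅FreeGroup.of v, FreeGroup.of w⁆}

/-- The right-angled Artin group `A Γ`. -/
abbrev Raag (Γ : Gph.{u}) : Type u := PresentedGroup (raagRels Γ)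

namespace Raag

/-- The generator of `A Γ` that belongs to the vertex `v`. -/
def of {Γ : Gph.{u}} (v : Γ.V) : Raag Γ := PresentedGroup.of v

theorem of_comm {Γ : Gph.{u}} {v w : Γ.V} (h : Γ.Adj v w) :
    (of v * of w : Raag Γ) = of w * of v := by
  have h1 : PresentedGroup.mk (raagRels Γ) ⁅FreeGroup.of v, FreeGroup.of w⁆ = 1 :=
    PresentedGroup.one_of_mem ⟨v, w, h, rfl⟩
  rw [map_commutatorElement, commutatorElement_eq_one_iff_mul_comm] at h1
  exact h1

/-- The universal property of `A Γ`. -/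
def lift {Γ : Gph.{u}} {G : Type u} [Group G] (x : Γ.V → G)
    (hx : ∀ v w, Γ.Adj v w → x v * x w = x w * x v) : Raag Γ →* G :=
  PresentedGroup.toGroup (f := x) (by
    rintro r ⟨v, w, hvw, rfl⟩
    rw [map_commutatorElement, FreeGroup.lift_apply_of, FreeGroup.lift_apply_of,
      commutatorElement_eq_one_iff_mul_comm]
    exact hx v w hvw)

theorem lift_of {Γ : Gph.{u}} {G : Type u} [Group G] (x : Γ.V → G)
    (hx : ∀ v w, Γ.Adj v w → x v * x w = x w * x v) (v : Γ.V) : lift x hx (of v) = x v :=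
  PresentedGroup.toGroup.of _

theorem hom_ext {Γ : Gph.{u}} {G : Type u} [Group G] {f g : Raag Γ →* G}
    (h : ∀ v, f (of v) = g (of v)) : f = g :=
  PresentedGroup.ext h

/-- The homomorphism `A φ`, which sends the generator `v` to the generator `φ v`. -/
def map {Γ Δ : Gph.{u}} (φ : Γ ⟶ Δ) : Raag Γ →* Raag Δ :=
  lift (fun v => of (φ.toFun v)) fun v w h => of_comm (φ.map_adj v w h)

theorem map_of {Γ Δ : Gph.{u}} (φ : Γ ⟶ Δ) (v : Γ.V) : map φ (of v) = of (φ.toFun v) :=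
  lift_of _ _ v

end Raag

/-- The functor `A : Gph ⥤ Grp`. -/
def raagFunctor : Gph.{u} ⥤ GrpCat.{u} where
  obj Γ := GrpCat.of (Raag Γ)
  map φ := GrpCat.ofHom (Raag.map φ)
  map_id _ := GrpCat.hom_ext (Raag.hom_ext fun v => Raag.map_of _ v)
  map_comp φ ψ := GrpCat.hom_ext (Raag.hom_ext fun v =>
    (Raag.map_of _ v).trans
      ((congrArg (Raag.map ψ) (Raag.map_of φ v)).trans (Raag.map_of ψ _)).symm)

/-- The commutation graph `C G`: its vertices are the elements of `G`, and two of them are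
adjacent when they commute. -/
abbrev commutationGraph (G : Type u) [Group G] : Gph.{u} where
  V := G
  Adj g h := g * h = h * g
  symm _ _ h := h.symm
  refl _ := rfl

/-- The functor `C : Grp ⥤ Gph`. -/
def commutationFunctor : GrpCat.{u} ⥤ Gph.{u} where
  obj G := commutationGraph G
  map f :=
    { toFun := fun g => f.hom g
      map_adj := fun g h (hgh : g * h = h * g) =>
        (map_mul f.hom g h).symm.trans ((congrArg f.hom hgh).trans (map_mul f.hom h g)) }

/-- The graph homomorphism `η : Γ → C (A Γ)`, `v ↦ v`. -/
def raagUnit (Γ : Gph.{u}) : Γ ⟶ commutationGraph (Raag Γ) where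
  toFun v := Raag.of v
  map_adj _ _ h := Raag.of_comm h

/-- The homomorphism `ε : AC G → G`, `[g] ↦ g`. -/
def raagCounit (G : Type u) [Group G] : Raag (commutationGraph G) →* G :=
  Raag.lift (Γ := commutationGraph G) (fun g => g) fun _ _ h => h

theorem raagCounit_of {G : Type u} [Group G] (g : G) :
    raagCounit G (Raag.of (Γ := commutationGraph G) g) = g :=
  Raag.lift_of (Γ := commutationGraph G) _ _ g

/-- The adjunction `A ⊣ C`, with unit `η` and counit `ε`. -/
def raagAdjunction : raagFunctor.{u} ⊣ commutationFunctor.{u} :=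
  Adjunction.mkOfUnitCounit
    { unit :=
        { app := raagUnit
          naturality := fun _ _ φ => Gph.Hom.ext (funext fun v => (Raag.map_of φ v).symm) }
      counit :=
        { app := fun G => GrpCat.ofHom (raagCounit G)
          naturality := fun G H f => GrpCat.hom_ext (Raag.hom_ext fun g =>
            ((congrArg (raagCounit H) (Raag.map_of (commutationFunctor.map f) g)).trans
              (raagCounit_of (f.hom g))).trans (congrArg f.hom (raagCounit_of (G := G) g)).symm) }
      left_triangle := NatTrans.ext (funext fun Γ => GrpCat.hom_ext (Raag.hom_ext fun v =>
        (congrArg (raagCounit (Raag Γ)) (Raag.map_of (raagUnit Γ) v)).trans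
          (raagCounit_of (Raag.of v))))
      right_triangle := NatTrans.ext (funext fun G => Gph.Hom.ext (funext fun g =>
        raagCounit_of (G := G) g)) }

/-- The comonad `AC` on groups. -/
abbrev acComonad : Comonad GrpCat.{u} := raagAdjunction.toComonad

/-- Groups with an `AC`-coalgebra structure: `G.A` is the group, `G.a : G.A ⟶ AC G.A` is the
structure map. Morphisms are the `AC`-cohomomorphisms. -/
abbrev ACCoalgebra : Type (u + 1) := acComonad.{u}.Coalgebra

/-- A graph presenting the coalgebra `G`: a graph `Γ` with an isomorphism of coalgebras between
`A Γ`, with its canonical structure map `A η : A Γ ⟶ AC (A Γ)`, and `G`. -/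
structure GraphPresentation (G : ACCoalgebra.{u}) where
  graph : Gph.{u}
  iso : (Comonad.comparison raagAdjunction).obj graph ≅ G

/-- Under the identifications of `G` with `A Γ` and of `H` with `A Δ`, the group homomorphism `f`
is `A φ` for some graph homomorphism `φ : Γ ⟶ Δ`. -/
def IsRaagMap {G H : ACCoalgebra.{u}} (p : GraphPresentation G) (q : GraphPresentation H)
    (f : G.A ⟶ H.A) : Prop :=
  ∃ φ : p.graph ⟶ q.graph, p.iso.hom.f ≫ f = raagFunctor.map φ ≫ q.iso.hom.f

/-! ### Finite descriptions of the data -/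

/-- A word in letters from `α` and their formal inverses; `(a, true)` is the letter `a` and
`(a, false)` is its inverse. -/
abbrev GWord (α : Type) : Type := List (α × Bool)

/-- The element of `G` that a word describes, when the letter `a` stands for `x a`. -/
def GWord.eval {α : Type} {G : Type u} [Group G] (x : α → G) (w : GWord α) : G :=
  FreeGroup.lift x (FreeGroup.mk w)

/-- A word `[w₁]^{±1} ⋯ [wₖ]^{±1}` in the formal generators of `AC G`, where each `wⱼ` is itself a
word in the letters `α`. -/
abbrev ACWord (α : Type) : Type := GWord (GWord α)

/-- The element of `AC G` that such a word describes, when the letter `a` stands for `x a`. -/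
def ACWord.eval {α : Type} {G : GrpCat.{u}} (x : α → G) (W : ACWord α) : acComonad.obj G :=
  GWord.eval (G := Raag (commutationGraph G))
    (fun w : GWord α => Raag.of (Γ := commutationGraph G) (GWord.eval x w)) W

/-- `⟨x₁, …, xₙ | rels⟩` is a presentation of the group `G`. -/
def Presents {n : ℕ} {G : Type u} [Group G] (x : Fin n → G) (rels : List (GWord (Fin n))) : Prop :=
  Function.Surjective (FreeGroup.lift x) ∧
    (FreeGroup.lift x).ker = Subgroup.normalClosure {r | ∃ w ∈ rels, r = FreeGroup.mk w}

/-- A finite description of a homomorphism between finitely presented groups with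
`AC`-coalgebra structures: finite presentations of both groups, the values of both structure maps
on the generators, and the values of the homomorphism on the generators, all given by words. -/
structure InputData where
  n : ℕ
  relsG : List (GWord (Fin n))
  coactG : Fin n → ACWord (Fin n)
  m : ℕ
  relsH : List (GWord (Fin m))
  coactH : Fin m → ACWord (Fin m)
  map : Fin n → GWord (Fin m)

/-- `d` describes `f : G ⟶ H` together with the coalgebras `G` and `H`, where the letters of `d`
stand for the generators `x` of `G` and `y` of `H`. -/
structure InputData.Describes (d : InputData) {G H : ACCoalgebra.{u}} (f : G.A ⟶ H.A)
    (x : Fin d.n → G.A) (y : Fin d.m → H.A) : Prop where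
  presG : Presents x d.relsG
  presH : Presents y d.relsH
  coactG : ∀ i, G.a.hom (x i) = ACWord.eval x (d.coactG i)
  coactH : ∀ j, H.a.hom (y j) = ACWord.eval y (d.coactH j)
  map : ∀ i, f.hom (x i) = GWord.eval y (d.map i)

/-- Rename the letters of a word. -/
def GWord.rename {α β : Type} (e : α → β) (w : GWord α) : GWord β :=
  w.map (Prod.map e id)

/-- The type of the finite strings that the algorithm reads. -/
abbrev InputCode : Type :=
  (ℕ × List (GWord ℕ) × List (ACWord ℕ)) × (ℕ × List (GWord ℕ) × List (ACWord ℕ)) × List (GWord ℕ)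

/-- The input as the algorithm reads it: letters are replaced by their numbers, and the values on
the generators are listed in order. -/
def InputData.code (d : InputData) : InputCode :=
  ((d.n, d.relsG.map (GWord.rename Fin.val),
      List.ofFn fun i => GWord.rename (GWord.rename Fin.val) (d.coactG i)),
    (d.m, d.relsH.map (GWord.rename Fin.val),
      List.ofFn fun j => GWord.rename (GWord.rename Fin.val) (d.coactH j)),
    List.ofFn fun i => GWord.rename Fin.val (d.map i))

/-!
In an `AC`-coalgebra `(G, 𝔤)` call `g` group-like if `𝔤 g = [g]`. The group-like elements are the
equalizer of the coreflexive pair of graph homomorphisms `C 𝔤, η : C G ⇉ C A C G`. Retractions onto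
special subgroups show that an element of `AC G` which `A` of both maps sends to the same place is a
product of generators `[h]^{±1}` with `h` group-like. By coassociativity this applies to every value
of `𝔤`, so `G` is the right-angled Artin group on its group-like elements, and `f : G → H` has the
form `A φ` if and only if it maps group-like elements to group-like elements.

Moreover `g` is group-like if and only if `[g]` has nonzero exponent sum in `𝔤 x` for some generator
`x`. Hence all group-like elements occur among the finitely many letters of the given words for the
`𝔤 x`, and the question comes down to finitely many instances of the word problem in `G` and `H`.

Right-angled Artin groups are residually finite: a reduced word `v₁ ^ t₁ ⋯ vₖ ^ tₖ` is detected by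
an action of `A Γ` on the partial fillings `c : Fin k → ZMod N` of its exponents. So the word
problem is decided, uniformly in the presentation, by searching in parallel for an expression of the
word as a product of conjugates of relators and their inverses, and for a finite permutation
representation of the group in which the word is nontrivial.
-/

/-! ### Special subgroups of right-angled Artin groups -/

namespace Raag

section UniversalProperty

variable {Γ Δ : Gph.{u}}

/-- The universal property of `A Γ`, for target groups in an arbitrary universe. -/
def toGroup {G : Type*} [Group G] (x : Γ.V → G)
    (hx : ∀ v w, Γ.Adj v w → Commute (x v) (x w)) : Raag Γ →* G :=
  PresentedGroup.toGroup (f := x) (by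
    rintro r ⟨v, w, hvw, rfl⟩
    rw [map_commutatorElement, FreeGroup.lift_apply_of, FreeGroup.lift_apply_of,
      commutatorElement_eq_one_iff_mul_comm]
    exact hx v w hvw)

theorem toGroup_of {G : Type*} [Group G] (x : Γ.V → G)
    (hx : ∀ v w, Γ.Adj v w → Commute (x v) (x w)) (v : Γ.V) : toGroup x hx (of v) = x v :=
  PresentedGroup.toGroup.of _

theorem map_map {Θ : Gph.{u}} (φ : Γ ⟶ Δ) (ψ : Δ ⟶ Θ) (z : Raag Γ) :
    map ψ (map φ z) = map (φ ≫ ψ) z :=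
  DFunLike.congr_fun (congrArg GrpCat.Hom.hom (raagFunctor.map_comp φ ψ)).symm z

theorem map_id (z : Raag Γ) : map (𝟙 Γ) z = z :=
  DFunLike.congr_fun (congrArg GrpCat.Hom.hom (raagFunctor.map_id Γ)) z

end UniversalProperty

section SpecialSubgroup

variable {Γ Δ : Gph.{u}}

/-- The special subgroup of `A Γ` on a set of vertices `S`: the subgroup that `S` generates. -/
def specialSubgroup (S : Set Γ.V) : Subgroup (Raag Γ) :=
  Subgroup.closure (of '' S)

theorem specialSubgroup_le {S : Set Γ.V} {K : Subgroup (Raag Γ)} :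
    specialSubgroup S ≤ K ↔ ∀ v ∈ S, of v ∈ K := by
  rw [specialSubgroup, Subgroup.closure_le, Set.image_subset_iff]
  rfl

theorem of_mem_specialSubgroup {S : Set Γ.V} {v : Γ.V} (hv : v ∈ S) :
    of v ∈ specialSubgroup S :=
  specialSubgroup_le.1 le_rfl v hv

theorem specialSubgroup_univ : specialSubgroup (Set.univ : Set Γ.V) = ⊤ := by
  rw [specialSubgroup, Set.image_univ]
  exact PresentedGroup.closure_range_of _

theorem map_specialSubgroup (φ : Γ ⟶ Δ) (S : Set Γ.V) :
    (specialSubgroup S).map (map φ) = specialSubgroup (φ.toFun '' S) := by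
  rw [specialSubgroup, specialSubgroup, MonoidHom.map_closure, Set.image_image, Set.image_image]
  simp only [map_of]

theorem map_mem_specialSubgroup (φ : Γ ⟶ Δ) (z : Raag Γ) :
    map φ z ∈ specialSubgroup (Set.range φ.toFun) := by
  rw [← Set.image_univ, ← map_specialSubgroup, specialSubgroup_univ]
  exact ⟨z, trivial, rfl⟩

open Classical in
/-- The retraction of `A Γ` onto the special subgroup on `S`, which kills the vertices outside
`S`. -/
noncomputable def retraction (S : Set Γ.V) : Raag Γ →* Raag Γ :=
  lift (fun v => if v ∈ S then of v else 1) fun v w h => by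
    split_ifs <;> simp only [of_comm h, mul_one, one_mul]

theorem retraction_of_mem {S : Set Γ.V} {v : Γ.V} (h : v ∈ S) : retraction S (of v) = of v := by
  rw [retraction, lift_of, if_pos h]

theorem retraction_of_notMem {S : Set Γ.V} {v : Γ.V} (h : v ∉ S) : retraction S (of v) = 1 := by
  rw [retraction, lift_of, if_neg h]

theorem retraction_eq_self {S : Set Γ.V} {z : Raag Γ} (hz : z ∈ specialSubgroup S) :
    retraction S z = z :=
  have h : specialSubgroup S ≤ (retraction S).eqLocus (MonoidHom.id _) :=
    specialSubgroup_le.2 fun _ hv => retraction_of_mem hv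
  h hz

theorem retraction_mem_specialSubgroup_inter (S : Set Γ.V) {T : Set Γ.V} {z : Raag Γ}
    (hz : z ∈ specialSubgroup T) : retraction S z ∈ specialSubgroup (S ∩ T) := by
  have h : specialSubgroup T ≤ (specialSubgroup (S ∩ T)).comap (retraction S) := by
    refine specialSubgroup_le.2 fun v hT => ?_
    rw [Subgroup.mem_comap]
    by_cases hS : v ∈ S
    · rw [retraction_of_mem hS]
      exact of_mem_specialSubgroup ⟨hS, hT⟩
    · rw [retraction_of_notMem hS]
      exact one_mem _
  exact h hz

theorem specialSubgroup_inf_specialSubgroup (S T : Set Γ.V) :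
    specialSubgroup S ⊓ specialSubgroup T = specialSubgroup (S ∩ T) := by
  refine le_antisymm (fun z hz => ?_) (le_inf ?_ ?_)
  · rw [← retraction_eq_self hz.1]
    exact retraction_mem_specialSubgroup_inter S hz.2
  · exact specialSubgroup_le.2 fun v hv => of_mem_specialSubgroup hv.1
  · exact specialSubgroup_le.2 fun v hv => of_mem_specialSubgroup hv.2

-- The functor `A` preserves equalizers of coreflexive pairs, as far as generators go.
theorem mem_specialSubgroup_of_map_eq_map {p q : Γ ⟶ Δ} {r : Δ ⟶ Γ} (hp : p ≫ r = 𝟙 Γ)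
    (hq : q ≫ r = 𝟙 Γ) {z : Raag Γ} (hz : map p z = map q z) :
    z ∈ specialSubgroup {v | p.toFun v = q.toFun v} := by
  have hpz : map p z ∈ specialSubgroup (Set.range p.toFun ∩ Set.range q.toFun) := by
    rw [← specialSubgroup_inf_specialSubgroup]
    exact ⟨map_mem_specialSubgroup p z, hz ▸ map_mem_specialSubgroup q z⟩
  have hrpz := Subgroup.mem_map_of_mem (map r) hpz
  rw [map_specialSubgroup, map_map, hp, map_id] at hrpz
  refine specialSubgroup_le.2 ?_ hrpz
  rintro _ ⟨_, ⟨⟨v, rfl⟩, ⟨w, hw⟩⟩, rfl⟩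
  have hpv : r.toFun (p.toFun v) = v := congrFun (congrArg Gph.Hom.toFun hp) v
  have hqw : r.toFun (q.toFun w) = w := congrFun (congrArg Gph.Hom.toFun hq) w
  have hvw : w = v := by rw [← hqw, hw, hpv]
  rw [hpv]
  exact of_mem_specialSubgroup (hvw ▸ hw.symm)

end SpecialSubgroup

section ExponentSum

variable {Γ : Gph.{u}}

open Classical in
/-- The exponent sum of the vertex `v`. -/
noncomputable def expSum (v : Γ.V) : Raag Γ →* Multiplicative ℤ :=
  toGroup (Pi.mulSingle v (Multiplicative.ofAdd 1)) fun _ _ _ => Commute.all _ _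

theorem expSum_of_self (v : Γ.V) : expSum v (of v) = Multiplicative.ofAdd 1 := by
  classical exact (toGroup_of _ _ v).trans (Pi.mulSingle_eq_same _ _)

theorem expSum_of_ne {v w : Γ.V} (h : w ≠ v) : expSum v (of w) = 1 := by
  classical exact (toGroup_of _ _ w).trans (Pi.mulSingle_eq_of_ne h _)

theorem mem_of_of_mem_specialSubgroup {S : Set Γ.V} {z : Raag Γ} (hz : z ∈ specialSubgroup S)
    {v : Γ.V} (hv : expSum v z ≠ 1) : v ∈ S := by
  by_contra hvS
  have h : specialSubgroup S ≤ (expSum v).ker :=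
    specialSubgroup_le.2 fun w hw => expSum_of_ne (ne_of_mem_of_not_mem hw hvS)
  exact hv (h hz)

end ExponentSum

open Classical in
theorem adj_of_commute {Γ : Gph.{u}} {v w : Γ.V} (h : Commute (of v : Raag Γ) (of w)) :
    Γ.Adj v w := by
  by_contra hvw
  have hne : w ≠ v := by rintro rfl; exact hvw (Γ.refl _)
  let x : Γ.V → Equiv.Perm (Fin 3) := fun a =>
    if a = v then Equiv.swap 0 1 else if a = w then Equiv.swap 1 2 else 1
  have hx : ∀ a b, Γ.Adj a b → Commute (x a) (x b) := by
    intro a b hab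
    have hba := Γ.symm _ _ hab
    dsimp only [x]
    split_ifs <;> first | exact Commute.refl _ | exact Commute.one_left _ |
      exact Commute.one_right _ | (subst_vars; contradiction)
  have hS₃ := h.map (toGroup x hx)
  rw [toGroup_of, toGroup_of] at hS₃
  simp only [x, if_true, if_neg hne] at hS₃
  revert hS₃
  unfold Commute SemiconjBy
  decide

end Raag

/-! ### Group-like elements of coalgebras -/

section Coalgebra

variable {G : Type u} [Group G]

/-- The graph homomorphism `C f` induced by a group homomorphism `f`. -/
def commutationMap {H : Type u} [Group H] (f : G →* H) :
    commutationGraph G ⟶ commutationGraph H where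
  toFun := f
  map_adj _ _ h := Commute.map h f

/-- The elements `g` at which the structure map `c` takes the value `[g]`. -/
def groupLike (c : G →* Raag (commutationGraph G)) : Set G :=
  {g | c g = Raag.of (Γ := commutationGraph G) g}

/-- The full subgraph of `C G` on the group-like elements. -/
def groupLikeGraph (c : G →* Raag (commutationGraph G)) : Gph.{u} where
  V := groupLike c
  Adj g h := (g : G) * h = h * g
  symm _ _ h := h.symm
  refl _ := rfl

/-- The canonical homomorphism from the right-angled Artin group on the group-like elements. -/
def groupLikeHom (c : G →* Raag (commutationGraph G)) : Raag (groupLikeGraph c) →* G :=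
  Raag.lift (Γ := groupLikeGraph c) (fun g => (g.1 : G)) fun _ _ h => h

variable {c : G →* Raag (commutationGraph G)}

theorem groupLikeHom_of (g : (groupLikeGraph c).V) : groupLikeHom c (Raag.of g) = g.1 :=
  Raag.lift_of _ _ g

open Classical in
theorem groupLikeHom_injective : Function.Injective (groupLikeHom c) := by
  let r : Raag (commutationGraph G) →* Raag (groupLikeGraph c) :=
    Raag.lift (Γ := commutationGraph G)
      (fun g => if h : g ∈ groupLike c then Raag.of (Γ := groupLikeGraph c) ⟨g, h⟩ else 1)
      fun g h hgh => by
        split_ifs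
        · exact Raag.of_comm (Γ := groupLikeGraph c) hgh
        all_goals simp only [mul_one, one_mul]
  have hr : (r.comp c).comp (groupLikeHom c) = MonoidHom.id _ := Raag.hom_ext fun g => by
    rw [MonoidHom.comp_apply, groupLikeHom_of, MonoidHom.comp_apply, show c g.1 = _ from g.2]
    exact (Raag.lift_of (Γ := commutationGraph G) _ _ g.1).trans (dif_pos g.2)
  exact Function.LeftInverse.injective (g := r.comp c) (DFunLike.congr_fun hr)

theorem coact_mem_specialSubgroup_groupLike (hε : (raagCounit G).comp c = MonoidHom.id G)
    (hδ : ∀ g, Raag.map (raagUnit (commutationGraph G)) (c g) = Raag.map (commutationMap c) (c g))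
    (g : G) : c g ∈ Raag.specialSubgroup (Γ := commutationGraph G) (groupLike c) :=
  Raag.mem_specialSubgroup_of_map_eq_map (p := commutationMap c)
    (q := raagUnit (commutationGraph G)) (r := commutationMap (raagCounit G))
    (Gph.Hom.ext (congrArg DFunLike.coe hε)) (Gph.Hom.ext (funext raagCounit_of)) (hδ g).symm

theorem groupLikeHom_surjective (hε : (raagCounit G).comp c = MonoidHom.id G)
    (hδ : ∀ g, Raag.map (raagUnit (commutationGraph G)) (c g) =
      Raag.map (commutationMap c) (c g)) :
    Function.Surjective (groupLikeHom c) := by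
  intro g
  have hle : Raag.specialSubgroup (Γ := commutationGraph G) (groupLike c) ≤
      (groupLikeHom c).range.comap (raagCounit G) :=
    Raag.specialSubgroup_le.2 fun v hv =>
      ⟨Raag.of ⟨v, hv⟩, (groupLikeHom_of _).trans (raagCounit_of v).symm⟩
  have hg := hle (coact_mem_specialSubgroup_groupLike hε hδ g)
  rwa [Subgroup.mem_comap, show raagCounit G (c g) = g from DFunLike.congr_fun hε g] at hg

theorem mem_groupLike_iff_exists_expSum_ne_one (hε : (raagCounit G).comp c = MonoidHom.id G)
    (hδ : ∀ g, Raag.map (raagUnit (commutationGraph G)) (c g) = Raag.map (commutationMap c) (c g))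
    {ι : Type*} {x : ι → G} (hx : Function.Surjective (FreeGroup.lift x)) (g : G) :
    g ∈ groupLike c ↔ ∃ i, Raag.expSum (Γ := commutationGraph G) g (c (x i)) ≠ 1 := by
  constructor
  · intro hg
    by_contra! h
    have htriv : ((Raag.expSum (Γ := commutationGraph G) g).comp c).comp (FreeGroup.lift x) = 1 :=
      FreeGroup.ext_hom _ _ fun i => by simpa using h i
    obtain ⟨z, rfl⟩ := hx g
    have hz : Raag.expSum (FreeGroup.lift x z) (c (FreeGroup.lift x z)) = 1 :=
      DFunLike.congr_fun htriv z
    rw [show c (FreeGroup.lift x z) = _ from hg, Raag.expSum_of_self] at hz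
    exact absurd hz (by decide)
  · rintro ⟨i, hi⟩
    exact Raag.mem_of_of_mem_specialSubgroup (coact_mem_specialSubgroup_groupLike hε hδ (x i)) hi

end Coalgebra

namespace ACCoalgebra

/-- The structure map of a coalgebra as a homomorphism of groups. -/
def coact (G : ACCoalgebra.{u}) : G.A →* Raag (commutationGraph G.A) := G.a.hom

theorem counit_comp_coact (G : ACCoalgebra.{u}) :
    (raagCounit G.A).comp G.coact = MonoidHom.id G.A :=
  congrArg GrpCat.Hom.hom G.counit

theorem coassoc_coact (G : ACCoalgebra.{u}) (g : G.A) :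
    Raag.map (raagUnit (commutationGraph G.A)) (G.coact g) =
      Raag.map (commutationMap G.coact) (G.coact g) :=
  DFunLike.congr_fun (congrArg GrpCat.Hom.hom G.coassoc) g

theorem coact_hom {G H : ACCoalgebra.{u}} (f : G ⟶ H) (g : G.A) :
    Raag.map (commutationMap f.f.hom) (G.coact g) = H.coact (f.f.hom g) :=
  DFunLike.congr_fun (congrArg GrpCat.Hom.hom f.h) g

theorem map_mem_groupLike {G H : ACCoalgebra.{u}} (f : G ⟶ H) {g : G.A}
    (hg : g ∈ groupLike G.coact) : f.f.hom g ∈ groupLike H.coact := by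
  change H.coact _ = _
  rw [← coact_hom, show G.coact g = _ from hg]
  exact Raag.map_of (commutationMap f.f.hom) g

theorem mem_groupLike_iff (G : ACCoalgebra.{u}) {ι : Type*} {x : ι → G.A}
    (hx : Function.Surjective (FreeGroup.lift x)) (g : G.A) :
    g ∈ groupLike G.coact ↔
      ∃ i, Raag.expSum (Γ := commutationGraph G.A) g (G.coact (x i)) ≠ 1 :=
  mem_groupLike_iff_exists_expSum_ne_one G.counit_comp_coact G.coassoc_coact hx g

theorem nonempty_graphPresentation (G : ACCoalgebra.{u}) : Nonempty (GraphPresentation G) := by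
  let e : Raag (groupLikeGraph G.coact) ≃* G.A := MulEquiv.ofBijective (groupLikeHom G.coact)
    ⟨groupLikeHom_injective, groupLikeHom_surjective G.counit_comp_coact G.coassoc_coact⟩
  refine ⟨⟨groupLikeGraph G.coact, Comonad.Coalgebra.isoMk e.toGrpIso ?_⟩⟩
  refine GrpCat.hom_ext (Raag.hom_ext (Γ := groupLikeGraph G.coact) fun v => ?_)
  change Raag.map (commutationMap e.toMonoidHom) (Raag.map (raagUnit _) (Raag.of v)) =
    G.coact (groupLikeHom G.coact (Raag.of v))
  rw [Raag.map_of, groupLikeHom_of, show G.coact v.1 = _ from v.2]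
  refine (Raag.map_of (commutationMap e.toMonoidHom) _).trans ?_
  exact congrArg _ (groupLikeHom_of v)

end ACCoalgebra

theorem Raag.mem_range_of_of_map_raagUnit {Γ : Gph.{u}} {z : Raag Γ}
    (hz : Raag.map (raagUnit Γ) z = Raag.of (Γ := commutationGraph (Raag Γ)) z) :
    z ∈ Set.range (Raag.of : Γ.V → Raag Γ) := by
  have hmem := Raag.map_mem_specialSubgroup (raagUnit Γ) z
  rw [hz] at hmem
  refine Raag.mem_of_of_mem_specialSubgroup hmem (v := z) ?_
  rw [Raag.expSum_of_self (Γ := commutationGraph (Raag Γ))]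
  decide

namespace GraphPresentation

variable {G : ACCoalgebra.{u}} (p : GraphPresentation G)

/-- The isomorphism of groups that underlies a graph presentation. -/
def mulEquiv : Raag p.graph ≃* G.A :=
  ((Comonad.forget acComonad).mapIso p.iso).groupIsoToMulEquiv

theorem mem_groupLike_iff {g : G.A} :
    g ∈ groupLike G.coact ↔ ∃ v, p.mulEquiv (Raag.of v) = g := by
  constructor
  · intro hg
    obtain ⟨v, hv⟩ := Raag.mem_range_of_of_map_raagUnit (z := p.mulEquiv.symm g)
      (ACCoalgebra.map_mem_groupLike p.iso.inv hg)
    exact ⟨v, by rw [hv, MulEquiv.apply_symm_apply]⟩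
  · rintro ⟨v, rfl⟩
    exact ACCoalgebra.map_mem_groupLike p.iso.hom (Raag.map_of (raagUnit p.graph) v)

end GraphPresentation

theorem isRaagMap_iff_mapsTo_groupLike {G H : ACCoalgebra.{u}} (p : GraphPresentation G)
    (q : GraphPresentation H) (f : G.A ⟶ H.A) :
    IsRaagMap p q f ↔ Set.MapsTo f.hom (groupLike G.coact) (groupLike H.coact) := by
  constructor
  · rintro ⟨φ, hφ⟩ g hg
    obtain ⟨v, rfl⟩ := p.mem_groupLike_iff.1 hg
    refine q.mem_groupLike_iff.2 ⟨φ.toFun v, ?_⟩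
    rw [← Raag.map_of]
    exact (DFunLike.congr_fun (congrArg GrpCat.Hom.hom hφ) (Raag.of v)).symm
  · intro h
    have hv (v : p.graph.V) : ∃ w, q.mulEquiv (Raag.of w) = f.hom (p.mulEquiv (Raag.of v)) :=
      q.mem_groupLike_iff.1 (h (p.mem_groupLike_iff.2 ⟨v, rfl⟩))
    choose φ hφ using hv
    have hadj (v w : p.graph.V) (hvw : p.graph.Adj v w) : q.graph.Adj (φ v) (φ w) := by
      have hcomm : Commute (Raag.of v) (Raag.of w) := Raag.of_comm hvw
      refine Raag.adj_of_commute (Commute.of_map q.mulEquiv.injective ?_)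
      rw [hφ, hφ]
      exact (hcomm.map p.mulEquiv).map f.hom
    refine ⟨⟨φ, hadj⟩, GrpCat.hom_ext (Raag.hom_ext fun v => ?_)⟩
    change f.hom (p.mulEquiv (Raag.of v)) = q.mulEquiv (Raag.map ⟨φ, hadj⟩ (Raag.of v))
    rw [Raag.map_of, hφ]

/-! ### Residual finiteness of right-angled Artin groups -/

namespace Raag

section ReducedWords

variable {Γ : Gph.{u}}

/-- The element of `A Γ` described by a list of syllables, that is, of powers of vertices. -/
def syllableProd (L : List (Γ.V × ℤ)) : Raag Γ := (L.map fun s => of s.1 ^ s.2).prod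

theorem syllableProd_append (L M : List (Γ.V × ℤ)) :
    syllableProd (L ++ M) = syllableProd L * syllableProd M := by
  rw [syllableProd, List.map_append, List.prod_append]
  rfl

theorem syllableProd_cons (s : Γ.V × ℤ) (L : List (Γ.V × ℤ)) :
    syllableProd (s :: L) = of s.1 ^ s.2 * syllableProd L := by
  rw [syllableProd, List.map_cons, List.prod_cons]
  rfl

theorem syllableProd_surjective :
    Function.Surjective (syllableProd : List (Γ.V × ℤ) → Raag Γ) := by
  intro z
  have hz : z ∈ (FreeGroup.lift (of : Γ.V → Raag Γ)).range := by
    rw [FreeGroup.range_lift_eq_closure]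
    exact PresentedGroup.closure_range_of (raagRels Γ) ▸ Subgroup.mem_top z
  obtain ⟨⟨w⟩, rfl⟩ := hz
  refine ⟨w.map fun a => (a.1, cond a.2 1 (-1)), ?_⟩
  refine Eq.trans ?_ FreeGroup.lift_mk.symm
  rw [syllableProd, List.map_map]
  congr 2
  funext ⟨v, ε⟩
  cases ε
  · exact zpow_neg_one _
  · exact zpow_one _

theorem syllableProd_merge (A B C : List (Γ.V × ℤ)) {v : Γ.V} (hB : ∀ s ∈ B, Γ.Adj v s.1)
    (m n : ℤ) :
    syllableProd (A ++ (v, m) :: (B ++ (v, n) :: C)) =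
      syllableProd (A ++ (v, m + n) :: (B ++ C)) := by
  have hcomm : Commute (of v ^ n) (syllableProd B) := by
    refine Commute.list_prod_right _ _ fun x hx => ?_
    obtain ⟨s, hs, rfl⟩ := List.mem_map.1 hx
    exact Commute.zpow_zpow (of_comm (hB s hs)) _ _
  simp only [syllableProd_append, syllableProd_cons, zpow_add, mul_assoc, hcomm.left_comm]

/-- Any two occurrences of the same vertex are separated by a vertex not adjacent to it. -/
def IsSeparated {ι : Type*} [LT ι] (a : ι → Γ.V) : Prop :=
  ∀ i j, i < j → a i = a j → ∃ m, i < m ∧ m < j ∧ ¬ Γ.Adj (a i) (a m)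

/-- A list of syllables is reduced if no exponent vanishes and no two syllables can be merged. -/
structure IsReduced (L : List (Γ.V × ℤ)) : Prop where
  ne_zero : ∀ i : Fin L.length, L[i].2 ≠ 0
  isSeparated : IsSeparated fun i : Fin L.length => L[i].1

theorem isReduced_of_length_minimal {L : List (Γ.V × ℤ)}
    (hL : ∀ M, syllableProd M = syllableProd L → L.length ≤ M.length) : IsReduced L := by
  refine ⟨fun i hi => ?_, fun i j hij hlab => ?_⟩
  · have hsplit : L = L.take i ++ L[i] :: L.drop (i + 1) := by simp
    have hdel := hL (L.take i ++ L.drop (i + 1)) <| by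
      conv_rhs => rw [hsplit]
      rw [syllableProd_append, syllableProd_append, syllableProd_cons, hi, zpow_zero, one_mul]
    have hlen := congrArg List.length hsplit
    simp only [List.length_append, List.length_cons] at hdel hlen
    lia
  · by_contra! hadj
    have hB : ∀ s ∈ (L.take j).drop (i + 1), Γ.Adj L[i].1 s.1 := by
      intro s hs
      obtain ⟨m, hm, rfl⟩ := List.mem_iff_getElem.1 hs
      rw [List.length_drop, List.length_take] at hm
      rw [List.getElem_drop, List.getElem_take]
      exact hadj ⟨i + 1 + m, by lia⟩ (Fin.lt_def.2 (by simp only; lia))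
        (Fin.lt_def.2 (by simp only; lia))
    have hsplit : L.take i ++ (L[i].1, L[i].2) ::
        ((L.take j).drop (i + 1) ++ (L[i].1, L[j].2) :: L.drop (j + 1)) = L := by
      have hi : i < (L.take j).length := by rw [List.length_take]; lia
      have htake : L.take i ++ L[i] :: (L.take j).drop (i + 1) = L.take j := by
        conv_rhs => rw [← List.take_append_drop i (L.take j), List.drop_eq_getElem_cons hi]
        rw [List.take_take, min_eq_left (Fin.le_def.1 hij.le), List.getElem_take]
        rfl
      rw [show (L[i].1, L[j].2) = L[j] from Prod.ext hlab rfl, ← List.cons_append,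
        ← List.append_assoc]
      refine Eq.trans ?_ (List.take_append_drop j L)
      rw [List.drop_eq_getElem_cons j.2]
      exact congrArg (· ++ _) htake
    have hmerge := hL (L.take i ++ (L[i].1, L[i].2 + L[j].2) ::
        ((L.take j).drop (i + 1) ++ L.drop (j + 1))) <| by
      conv_rhs => rw [← hsplit]
      exact (syllableProd_merge _ _ _ hB _ _).symm
    have hlen := congrArg List.length hsplit
    simp only [List.length_append, List.length_cons] at hmerge hlen
    lia

theorem exists_isReduced (z : Raag Γ) : ∃ L : List (Γ.V × ℤ), IsReduced L ∧ syllableProd L = z := by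
  obtain ⟨L, rfl, hL⟩ := (measure List.length).wf.has_min {L : List (Γ.V × ℤ) | syllableProd L = z}
    (syllableProd_surjective z)
  exact ⟨L, isReduced_of_length_minimal fun M hM => not_lt.1 (hL M hM), rfl⟩

end ReducedWords

section Fillings

variable {Γ : Gph.{u}} {ι R : Type*} [LinearOrder ι] [Ring R]

/-- For a list of syllables with vertices `a` and exponents `t`, a filling `c` says how much of
each exponent has been used so far. A syllable is active in `c` if all later syllables that do not
commute with it are full, and all earlier ones are empty. This is the set of active syllables at
the vertex `v`. -/
def activeSet (a : ι → Γ.V) (t c : ι → R) (v : Γ.V) : Set ι :=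
  {i | a i = v ∧ ∀ m, (v = a m ∨ ¬ Γ.Adj v (a m)) → (m < i → c m = 0) ∧ (i < m → c m = t m)}

/-- Add `e` to the content of the active syllable at the vertex `v`, if there is one. -/
noncomputable def fill (a : ι → Γ.V) (t : ι → R) (v : Γ.V) (e : R) (c : ι → R) : ι → R :=
  c + (activeSet a t c v).indicator fun _ => e

variable {a : ι → Γ.V} {t : ι → R}

theorem fill_zero (v : Γ.V) (c : ι → R) : fill a t v 0 c = c := by
  simp only [fill, Set.indicator_zero]
  exact add_zero c

theorem fill_apply_of_notMem {c : ι → R} {v : Γ.V} {m : ι} (hm : m ∉ activeSet a t c v) (e : R) :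
    fill a t v e c m = c m := by
  rw [fill, Pi.add_apply, Set.indicator_of_notMem hm, add_zero]

theorem activeSet_fill_of_ne {v w : Γ.V} (hne : v ≠ w) (hvw : Γ.Adj v w) (e : R) (c : ι → R) :
    activeSet a t (fill a t w e c) v = activeSet a t c v := by
  ext i
  refine and_congr_right fun _ => forall₂_congr fun m hm => ?_
  rw [fill_apply_of_notMem]
  rintro ⟨rfl, -⟩
  exact hm.elim hne (not_not_intro hvw)

variable (ht : ∀ m, t m ≠ 0) (ha : IsSeparated a)
include ht ha

theorem activeSet_subsingleton (c : ι → R) (v : Γ.V) : (activeSet a t c v).Subsingleton := by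
  have hlt : ∀ i ∈ activeSet a t c v, ∀ j ∈ activeSet a t c v, ¬ i < j := by
    rintro i ⟨rfl, hi⟩ j ⟨hij, hj⟩ hlt
    obtain ⟨m, him, hmj, hm⟩ := ha i j hlt hij.symm
    exact ht m (((hi m (.inr hm)).2 him).symm.trans ((hj m (.inr hm)).1 hmj))
  exact fun i hi j hj => le_antisymm (not_lt.1 (hlt j hj i hi)) (not_lt.1 (hlt i hi j hj))

theorem fill_of_mem_activeSet {c : ι → R} {v : Γ.V} {i : ι} (hi : i ∈ activeSet a t c v) (e : R) :
    fill a t v e c = Function.update c i (c i + e) := by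
  funext m
  rcases eq_or_ne m i with rfl | hm
  · rw [fill, Pi.add_apply, Set.indicator_of_mem hi, Function.update_self]
  · rw [Function.update_of_ne hm, fill_apply_of_notMem]
    exact fun hmem => hm (activeSet_subsingleton ht ha c v hmem hi)

theorem activeSet_fill_self (v : Γ.V) (e : R) (c : ι → R) :
    activeSet a t (fill a t v e c) v = activeSet a t c v := by
  rcases (activeSet a t c v).eq_empty_or_nonempty with hempty | ⟨i, hi⟩
  · have hfill : fill a t v e c = c :=
      funext fun m => fill_apply_of_notMem (hempty ▸ Set.notMem_empty m) e
    rw [hfill]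
  · have hi' : i ∈ activeSet a t (fill a t v e c) v := by
      refine ⟨hi.1, fun m hm => ?_⟩
      rw [fill_of_mem_activeSet ht ha hi]
      refine ⟨fun h => ?_, fun h => ?_⟩
      · rw [Function.update_of_ne h.ne]; exact (hi.2 m hm).1 h
      · rw [Function.update_of_ne h.ne']; exact (hi.2 m hm).2 h
    rw [(activeSet_subsingleton ht ha _ v).eq_singleton_of_mem hi',
      (activeSet_subsingleton ht ha _ v).eq_singleton_of_mem hi]

theorem fill_fill_of_adj {v w : Γ.V} (hvw : Γ.Adj v w) (e e' : R) (c : ι → R) :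
    fill a t v e (fill a t w e' c) =
      c + (activeSet a t c w).indicator (fun _ => e') +
        (activeSet a t c v).indicator fun _ => e := by
  have hset : activeSet a t (fill a t w e' c) v = activeSet a t c v := by
    rcases eq_or_ne v w with rfl | hne
    · exact activeSet_fill_self ht ha v e' c
    · exact activeSet_fill_of_ne hne hvw e' c
  rw [fill, hset, fill]

theorem fill_add (v : Γ.V) (e e' : R) (c : ι → R) :
    fill a t v (e + e') c = fill a t v e (fill a t v e' c) := by
  rw [fill_fill_of_adj ht ha (Γ.refl v), fill, add_comm e, add_assoc, ← Set.indicator_add']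
  rfl

/-- The action of the additive group of `R` on fillings by `Raag.fill` at the vertex `v`. -/
noncomputable def fillPerm (v : Γ.V) : Multiplicative R →* Equiv.Perm (ι → R) :=
  MonoidHom.toHomPerm
    { toFun := fun e => fill a t v e.toAdd
      map_one' := funext (fill_zero v)
      map_mul' := fun e e' => funext (fill_add ht ha v e.toAdd e'.toAdd) }

theorem fillPerm_apply (v : Γ.V) (e : Multiplicative R) (c : ι → R) :
    fillPerm ht ha v e c = fill a t v e.toAdd c :=
  rfl

theorem commute_fillPerm {v w : Γ.V} (hvw : Γ.Adj v w) (e e' : Multiplicative R) :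
    Commute (fillPerm ht ha v e) (fillPerm ht ha w e') :=
  Equiv.ext fun c =>
    (fill_fill_of_adj ht ha hvw _ _ c).trans ((add_right_comm _ _ _).trans
      (fill_fill_of_adj ht ha (Γ.symm _ _ hvw) _ _ c).symm)

/-- The action of `A Γ` on the fillings of a separated list of syllables, where each vertex adds
one unit to its active syllable. -/
noncomputable def fillHom : Raag Γ →* Equiv.Perm (ι → R) :=
  toGroup (fun v => fillPerm ht ha v (Multiplicative.ofAdd 1)) fun _ _ hvw =>
    commute_fillPerm ht ha hvw _ _

theorem fillHom_of_zpow (v : Γ.V) (n : ℤ) (c : ι → R) :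
    fillHom ht ha (of v ^ n) c = fill a t v n c := by
  rw [map_zpow, fillHom, toGroup_of, ← map_zpow, fillPerm_apply, toAdd_zpow, toAdd_ofAdd,
    zsmul_one]

end Fillings

section ResiduallyFinite

variable {Γ : Gph.{u}} {R : Type*} [Ring R] {L : List (Γ.V × ℤ)}

-- Reading the word from the right, each syllable is active when its turn comes.
theorem fillHom_syllableProd (ht : ∀ i : Fin L.length, (L[i].2 : R) ≠ 0) (hL : IsReduced L) :
    fillHom ht hL.isSeparated (syllableProd L) 0 = fun i => (L[i].2 : R) := by
  let suffix (j : ℕ) (i : Fin L.length) : R := if j ≤ i then L[i].2 else 0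
  have hact (j : ℕ) (hj : j < L.length) :
      ⟨j, hj⟩ ∈ activeSet (fun i : Fin L.length => L[i].1) (fun i => (L[i].2 : R))
        (suffix (j + 1)) L[j].1 :=
    ⟨rfl, fun m _ => ⟨fun h => if_neg (Fin.lt_def.1 h).le.not_gt, fun h => if_pos h⟩⟩
  have hstep (j : ℕ) (hj : j < L.length) :
      fillHom ht hL.isSeparated (of L[j].1 ^ L[j].2) (suffix (j + 1)) = suffix j := by
    rw [fillHom_of_zpow, fill_of_mem_activeSet ht hL.isSeparated (hact j hj)]
    funext m
    rcases eq_or_ne m ⟨j, hj⟩ with rfl | hm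
    · simp [suffix]
    · have hmj : (m : ℕ) ≠ j := fun h => hm (Fin.ext h)
      rw [Function.update_of_ne hm]
      exact if_congr ⟨fun h => by lia, fun h => by lia⟩ rfl rfl
  have hsuffix : ∀ j ≤ L.length,
      fillHom ht hL.isSeparated (syllableProd (L.drop j)) (suffix L.length) = suffix j := by
    intro j hj
    induction hj using Nat.decreasingInduction with
    | self => rw [List.drop_length, show syllableProd [] = 1 from rfl, map_one]; rfl
    | of_succ j hj ih =>
      rw [List.drop_eq_getElem_cons hj, syllableProd_cons, map_mul, Equiv.Perm.mul_apply, ih,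
        hstep j hj]
  have hempty : suffix L.length = 0 := funext fun i => if_neg i.2.not_ge
  rw [← hempty]
  exact (hsuffix 0 (Nat.zero_le _)).trans (funext fun i => if_pos (Nat.zero_le _))

theorem exists_intCast_zmod_ne_zero {s : List ℤ} (hs : ∀ e ∈ s, e ≠ 0) :
    ∃ N : ℕ, NeZero N ∧ ∀ e ∈ s, (e : ZMod N) ≠ 0 := by
  refine ⟨(s.map Int.natAbs).sum + 1, inferInstance, fun e he h => ?_⟩
  have hdvd := Int.natCast_dvd.1 ((ZMod.intCast_zmod_eq_zero_iff_dvd _ _).1 h)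
  have hle := Nat.le_of_dvd (Int.natAbs_pos.2 (hs e he)) hdvd
  have hsum : e.natAbs ≤ (s.map Int.natAbs).sum :=
    List.single_le_sum (fun _ _ => Nat.zero_le _) _ (List.mem_map_of_mem he)
  lia

instance residuallyFinite (Γ : Gph.{u}) : Group.ResiduallyFinite (Raag Γ) := by
  refine Group.residuallyFinite_of_forall_exists_finite_monoidHom.{u, 0} (G := Raag Γ)
    fun z hz => ?_
  obtain ⟨L, hL, rfl⟩ := exists_isReduced z
  obtain ⟨N, _, hN⟩ := exists_intCast_zmod_ne_zero (s := L.map Prod.snd) fun e he => by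
    obtain ⟨s, hs, rfl⟩ := List.mem_map.1 he
    obtain ⟨i, hi, rfl⟩ := List.getElem_of_mem hs
    exact hL.ne_zero ⟨i, hi⟩
  have ht (i : Fin L.length) : (L[i].2 : ZMod N) ≠ 0 :=
    hN _ (List.mem_map_of_mem (List.getElem_mem i.2))
  refine ⟨Equiv.Perm (Fin L.length → ZMod N), Equiv.Perm.permGroup, inferInstance,
    fillHom ht hL.isSeparated, fun h => hz ?_⟩
  have hfull := fillHom_syllableProd ht hL
  rw [h, Equiv.Perm.one_apply] at hfull
  cases L with
  | nil => rfl
  | cons s L => exact absurd (congrFun hfull ⟨0, by simp⟩).symm (ht _)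

end ResiduallyFinite

end Raag

/-! ### Decidability of promise problems -/

section Promise

variable {α β σ τ : Type*} [Primcodable α] [Primcodable β] [Primcodable σ] [Primcodable τ]

/-- Computability of a promise problem: some partial recursive function agrees with `g` on the
inputs that lie in `S`. -/
def ComputableOn (S : Set α) (g : α → σ) : Prop :=
  ∃ t : α →. σ, Partrec t ∧ ∀ a ∈ S, g a ∈ t a

/-- Decidability of a promise problem: some partial recursive function halts on the inputs that
lie in `S` and decides whether they satisfy `P`. -/
def DecidableOn (S : Set α) (P : α → Prop) : Prop :=
  ∃ b : α → Bool, ComputableOn S b ∧ ∀ a ∈ S, b a = true ↔ P a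

namespace ComputableOn

variable {S : Set α}

theorem of_computable {g : α → σ} (hg : Computable g) : ComputableOn S g :=
  ⟨g, hg, fun _ _ => Part.mem_some _⟩

theorem comp {T : Set β} {g : β → σ} {f : α → β} (hg : ComputableOn T g) (hf : Computable f)
    (hST : Set.MapsTo f S T) : ComputableOn S fun a => g (f a) := by
  obtain ⟨t, ht, htg⟩ := hg
  exact ⟨fun a => t (f a), ht.comp hf, fun a ha => htg _ (hST ha)⟩

theorem computable₂_comp {h : σ → τ → β} {f : α → σ} {g : α → τ} (hh : Computable₂ h)
    (hf : ComputableOn S f) (hg : ComputableOn S g) : ComputableOn S fun a => h (f a) (g a) := by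
  obtain ⟨s, hs, hsf⟩ := hf
  obtain ⟨t, ht, htg⟩ := hg
  have hmap : Partrec₂ fun (a : α) (b : σ) => (t a).map (h b) :=
    (ht.comp .fst).map (hh.comp (Computable.snd.comp .fst) .snd).to₂
  exact ⟨fun a => (s a).bind fun b => (t a).map (h b), hs.bind hmap,
    fun a ha => Part.mem_bind (hsf a ha) (Part.mem_map _ (htg a ha))⟩

theorem list_countP {f : α → List β} {p : α → β → Bool} (hf : Computable f)
    (hp : ComputableOn {q : α × β | q.1 ∈ S} fun q => p q.1 q.2) :
    ComputableOn S fun a => (f a).countP (p a) := by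
  obtain ⟨t, ht, htp⟩ := hp
  have hstep : Partrec₂ fun (a : α) (q : ℕ × ℕ) =>
      (((f a)[q.1]?).casesOn (Part.some q.2) fun b =>
        (t (a, b)).map fun c => q.2 + bif c then 1 else 0 : Part ℕ) :=
    Partrec.optionCasesOn_right
      (Computable.list_getElem?.comp (hf.comp .fst) (Computable.fst.comp .snd))
      (Computable.snd.comp .snd)
      ((ht.comp (.pair (Computable.fst.comp .fst) .snd)).map
        (Primrec.nat_add.to_comp.comp
          (Computable.snd.comp (Computable.snd.comp (Computable.fst.comp .fst)))
          (Computable.cond .snd (.const 1) (.const 0))).to₂).to₂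
  refine ⟨_, Partrec.nat_rec (Computable.list_length.comp hf) (Computable.const 0).partrec hstep,
    fun a ha => ?_⟩
  suffices h : ∀ n, ((f a).take n).countP (p a) ∈ (Nat.rec (Part.some 0)
      (fun n s => s.bind fun k => ((f a)[n]?).casesOn (Part.some k) fun b =>
        (t (a, b)).map fun c => k + bif c then 1 else 0) n : Part ℕ) by
    have hlength := h (f a).length
    rwa [List.take_length] at hlength
  intro n
  induction n with
  | zero => exact Part.mem_some 0
  | succ n ih =>
    refine Part.mem_bind ih ?_
    rw [List.take_add_one, List.countP_append]
    cases (f a)[n]? with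
    | none => exact Part.mem_some _
    | some b =>
      rw [Option.toList_some, List.countP_singleton, ← Bool.cond_eq_ite]
      exact Part.mem_map (fun c => ((f a).take n).countP (p a) + bif c then 1 else 0)
        (htp (a, b) ha)

end ComputableOn

namespace DecidableOn

variable {S : Set α} {P Q : α → Prop}

theorem of_computablePred (hP : ComputablePred P) : DecidableOn S P := by
  obtain ⟨b, hb, rfl⟩ := ComputablePred.computable_iff.1 hP
  exact ⟨b, .of_computable hb, fun _ _ => Iff.rfl⟩

theorem of_rePred (hP : REPred P) (hQ : REPred Q) (h : ∀ a ∈ S, ¬ P a ↔ Q a) :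
    DecidableOn S P := by
  classical
  obtain ⟨t, ht, hPQ⟩ := Partrec.merge' (hP.map (Computable.const true).to₂)
    (hQ.map (Computable.const false).to₂)
  refine ⟨fun a => decide (P a), ⟨t, ht, fun a ha => ?_⟩, fun _ _ => decide_eq_true_iff⟩
  obtain ⟨hval, hdom⟩ := hPQ a
  have ht_dom : (t a).Dom := hdom.2 <| by
    simpa [Part.dom_iff_mem, ← h a ha] using em (P a)
  convert! Part.get_mem ht_dom
  have hget := hval _ (Part.get_mem ht_dom)
  simp only [Part.mem_map_iff, Part.mem_assert_iff, ← h a ha] at hget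
  rcases hget with ⟨_, ⟨hPa, -⟩, hb⟩ | ⟨_, ⟨hPa, -⟩, hb⟩
  · exact (decide_eq_true hPa).trans hb
  · exact (decide_eq_false hPa).trans hb

theorem comp {T : Set β} {P : β → Prop} {f : α → β} (hP : DecidableOn T P) (hf : Computable f)
    (hST : Set.MapsTo f S T) : DecidableOn S fun a => P (f a) := by
  obtain ⟨b, hb, hbP⟩ := hP
  exact ⟨fun a => b (f a), hb.comp hf hST, fun a ha => hbP _ (hST ha)⟩

theorem and (hP : DecidableOn S P) (hQ : DecidableOn S Q) : DecidableOn S fun a => P a ∧ Q a := by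
  obtain ⟨b, hb, hbP⟩ := hP
  obtain ⟨c, hc, hcQ⟩ := hQ
  exact ⟨fun a => b a && c a, .computable₂_comp (Primrec₂.to_comp Primrec.and) hb hc,
    fun a ha => by rw [Bool.and_eq_true, hbP a ha, hcQ a ha]⟩

theorem not (hP : DecidableOn S P) : DecidableOn S fun a => ¬ P a := by
  obtain ⟨b, ⟨t, ht, htb⟩, hbP⟩ := hP
  exact ⟨fun a => !b a, ⟨fun a => (t a).map Bool.not, ht.map (Primrec.not.to_comp.comp .snd).to₂,
    fun a ha => Part.mem_map _ (htb a ha)⟩, fun a ha => by simp [← hbP a ha]⟩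

theorem imp (hP : DecidableOn S P) (hQ : DecidableOn S Q) : DecidableOn S fun a => P a → Q a := by
  simpa only [not_and, not_not] using (hP.and hQ.not).not

theorem ne {f g : α → σ} (hf : ComputableOn S f) (hg : ComputableOn S g) :
    DecidableOn S fun a => f a ≠ g a := by
  classical
  exact ⟨fun a => decide (f a ≠ g a),
    .computable₂_comp (PrimrecRel.decide (Primrec.eq (α := σ)).not).to_comp hf hg,
    fun _ _ => decide_eq_true_iff⟩

theorem computableOn_countP {f : α → List β} {P : α → β → Prop} [∀ a, DecidablePred (P a)]
    (hf : Computable f) (hP : DecidableOn {q : α × β | q.1 ∈ S} fun q => P q.1 q.2) :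
    ComputableOn S fun a => (f a).countP (P a) := by
  obtain ⟨b, hb, hbP⟩ := hP
  obtain ⟨t, ht, htb⟩ := ComputableOn.list_countP (p := fun a c => b (a, c)) hf hb
  refine ⟨t, ht, fun a ha => ?_⟩
  convert! htb a ha using 1
  exact List.countP_congr fun c _ => by simpa using (hbP (a, c) ha).symm

theorem exists_mem_list {f : α → List β} {P : α → β → Prop} (hf : Computable f)
    (hP : DecidableOn {q : α × β | q.1 ∈ S} fun q => P q.1 q.2) :
    DecidableOn S fun a => ∃ b ∈ f a, P a b := by
  classical
  obtain ⟨b, hb, hbP⟩ := ne (computableOn_countP hf hP) (.of_computable (.const 0))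
  refine ⟨b, hb, fun a ha => ?_⟩
  simp [hbP a ha, List.countP_eq_zero]

theorem forall_mem_list {f : α → List β} {P : α → β → Prop} (hf : Computable f)
    (hP : DecidableOn {q : α × β | q.1 ∈ S} fun q => P q.1 q.2) :
    DecidableOn S fun a => ∀ b ∈ f a, P a b := by
  simpa only [not_exists, not_and, not_not] using
    (exists_mem_list (P := fun a c => ¬ P a c) hf hP.not).not

end DecidableOn

end Promise

theorem rePred_exists {α γ : Type*} [Primcodable α] [Primcodable γ] {V : α → γ → Prop}
    (hV : PrimrecRel V) : REPred fun a => ∃ c, V a c := by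
  classical
  have hsearch : Partrec fun a => Nat.rfindOpt fun k =>
      (Encodable.decode (α := γ) k).bind fun c => if V a c then some c else none :=
    Partrec.rfindOpt (Primrec.to_comp (Primrec.option_bind (Primrec.decode.comp Primrec.snd)
      (Primrec.ite (hV.comp (Primrec.fst.comp Primrec.fst) Primrec.snd)
        (Primrec.option_some.comp Primrec.snd) (.const none)).to₂))
  refine hsearch.dom_re.of_eq fun a => ?_
  rw [Nat.rfindOpt_dom]
  constructor
  · rintro ⟨k, c, hc⟩
    obtain ⟨c', -, hc'⟩ := Option.mem_bind_iff.1 hc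
    exact ⟨c', by_contra fun h => by simp [h] at hc'⟩
  · rintro ⟨c, hc⟩
    exact ⟨Encodable.encode c, c, by simp [hc]⟩

/-! ### The word problem in residually finite groups -/

/-- A presentation `⟨x₀, …, xₙ₋₁ | r₁, …, rₖ⟩` in the form in which an algorithm reads it. -/
abbrev PresentationCode : Type := ℕ × List (GWord ℕ)

namespace PresentationCode

/-- The relators of a presentation on infinitely many letters: the given ones are followed by the
superfluous letters `n, n + 1, …`, so that words in all letters describe elements of the group. -/
def relator (p : PresentationCode) (j : ℕ) : GWord ℕ :=
  p.2.getD j [(p.1 + (j - p.2.length), true)]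

/-- The kernel of the map from the free group on all letters to the group with presentation `p`. -/
def relatorSubgroup (p : PresentationCode) : Subgroup (FreeGroup ℕ) :=
  Subgroup.normalClosure (Set.range fun j => FreeGroup.mk (p.relator j))

instance (p : PresentationCode) : p.relatorSubgroup.Normal :=
  Subgroup.normalClosure_normal

theorem forall_relator_iff {p : PresentationCode} {P : GWord ℕ → Prop} :
    (∀ j, P (p.relator j)) ↔ (∀ r ∈ p.2, P r) ∧ ∀ i, p.1 ≤ i → P [(i, true)] := by
  refine ⟨fun h => ⟨fun r hr => ?_, fun i hi => ?_⟩, fun h j => ?_⟩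
  · obtain ⟨j, hj, rfl⟩ := List.getElem_of_mem hr
    simpa only [relator, List.getD_eq_getElem _ _ hj] using h j
  · have := h (p.2.length + (i - p.1))
    rwa [relator, List.getD_eq_default _ _ (Nat.le_add_right _ _), Nat.add_sub_cancel_left,
      Nat.add_sub_cancel' hi] at this
  · by_cases hj : j < p.2.length
    · rw [relator, List.getD_eq_getElem _ _ hj]
      exact h.1 _ (List.getElem_mem hj)
    · rw [relator, List.getD_eq_default _ _ (not_lt.1 hj)]
      exact h.2 _ (Nat.le_add_right _ _)

theorem relatorSubgroup_le_iff {p : PresentationCode} {N : Subgroup (FreeGroup ℕ)} [N.Normal] :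
    p.relatorSubgroup ≤ N ↔
      (∀ r ∈ p.2, FreeGroup.mk r ∈ N) ∧ ∀ i, p.1 ≤ i → FreeGroup.of i ∈ N := by
  rw [relatorSubgroup, ← Subgroup.normalClosure_subset_iff, Set.range_subset_iff]
  exact forall_relator_iff (P := fun r => FreeGroup.mk r ∈ N)

/-- The group with presentation `p`. -/
abbrev Carrier (p : PresentationCode) : Type := FreeGroup ℕ ⧸ p.relatorSubgroup

/-- A conjugate of a relator or of its inverse. -/
def conjugate (p : PresentationCode) (c : GWord ℕ × ℕ × Bool) : GWord ℕ :=
  c.1 ++ (if c.2.2 then p.relator c.2.1 else FreeGroup.invRev (p.relator c.2.1)) ++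
    FreeGroup.invRev c.1

theorem mk_conjugate (p : PresentationCode) (c : GWord ℕ × ℕ × Bool) :
    FreeGroup.mk (p.conjugate c) = FreeGroup.mk c.1 *
      (if c.2.2 then FreeGroup.mk (p.relator c.2.1) else (FreeGroup.mk (p.relator c.2.1))⁻¹) *
      (FreeGroup.mk c.1)⁻¹ := by
  simp only [conjugate, ← FreeGroup.mul_mk, FreeGroup.inv_mk, apply_ite FreeGroup.mk]

theorem mk_conjugate_mem (p : PresentationCode) (c : GWord ℕ × ℕ × Bool) :
    FreeGroup.mk (p.conjugate c) ∈ p.relatorSubgroup := by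
  have hrel : FreeGroup.mk (p.relator c.2.1) ∈ p.relatorSubgroup :=
    Subgroup.subset_normalClosure ⟨c.2.1, rfl⟩
  rw [mk_conjugate]
  refine Subgroup.Normal.conj_mem inferInstance _ ?_ _
  split_ifs
  exacts [hrel, inv_mem hrel]

theorem exists_mk_conjugate_eq {p : PresentationCode} {g : FreeGroup ℕ} {b : Bool}
    (hg : (if b then g else g⁻¹) ∈ Group.conjugatesOfSet
      (Set.range fun j => FreeGroup.mk (p.relator j))) :
    ∃ c, FreeGroup.mk (p.conjugate c) = g := by
  obtain ⟨_, ⟨j, rfl⟩, hj⟩ := Group.mem_conjugatesOfSet_iff.1 hg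
  obtain ⟨c, hc⟩ := isConj_iff.1 hj
  refine ⟨(c.toWord, j, b), ?_⟩
  rw [mk_conjugate, FreeGroup.mk_toWord]
  cases b
  · exact conj_inv.symm.trans (inv_eq_iff_eq_inv.2 hc)
  · exact hc

theorem mem_relatorSubgroup_iff {p : PresentationCode} {g : FreeGroup ℕ} :
    g ∈ p.relatorSubgroup ↔ ∃ L : List (GWord ℕ × ℕ × Bool),
      FreeGroup.mk (L.flatMap p.conjugate) = g := by
  constructor
  · intro hg
    rw [relatorSubgroup, Subgroup.normalClosure, ← Subgroup.mem_toSubmonoid,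
      Subgroup.closure_toSubmonoid] at hg
    obtain ⟨l, hl, rfl⟩ := Submonoid.exists_list_of_mem_closure hg
    clear hg
    induction l with
    | nil => exact ⟨[], rfl⟩
    | cons y l ih =>
      obtain ⟨hy, hl⟩ := List.forall_mem_cons.1 hl
      obtain ⟨L, hL⟩ := ih hl
      obtain ⟨c, hc⟩ : ∃ c, FreeGroup.mk (p.conjugate c) = y := hy.elim
        (exists_mk_conjugate_eq (b := true) ·) (exists_mk_conjugate_eq (b := false) ·)
      exact ⟨c :: L, by rw [List.flatMap_cons, ← FreeGroup.mul_mk, hc, hL, List.prod_cons]⟩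
  · rintro ⟨L, rfl⟩
    induction L with
    | nil => exact one_mem _
    | cons c L ih =>
      rw [List.flatMap_cons, ← FreeGroup.mul_mk]
      exact mul_mem (p.mk_conjugate_mem c) ih

end PresentationCode

/-- The product of a list of transpositions. -/
def swapProd (l : List (ℕ × ℕ)) : Equiv.Perm ℕ :=
  (l.map fun p => Equiv.swap p.1 p.2).prod

theorem swapProd_append (l m : List (ℕ × ℕ)) : swapProd (l ++ m) = swapProd l * swapProd m := by
  simp [swapProd]

theorem swapProd_reverse (l : List (ℕ × ℕ)) : swapProd l.reverse = (swapProd l)⁻¹ := by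
  simp [swapProd, List.prod_inv_reverse, Function.comp_def]

theorem swapProd_apply (l : List (ℕ × ℕ)) (s : ℕ) :
    swapProd l s = l.foldr (fun p s => if s = p.1 then p.2 else if s = p.2 then p.1 else s) s := by
  induction l with
  | nil => rfl
  | cons p l ih =>
    rw [List.foldr_cons, ← ih, ← Equiv.swap_apply_def]
    rfl

theorem swapProd_eq_one_iff {l : List (ℕ × ℕ)} :
    swapProd l = 1 ↔ ∀ p ∈ l, swapProd l p.1 = p.1 ∧ swapProd l p.2 = p.2 := by
  refine ⟨fun h => by simp [h], fun h => Equiv.ext fun s => ?_⟩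
  by_cases hs : ∃ p ∈ l, s = p.1 ∨ s = p.2
  · obtain ⟨p, hp, rfl | rfl⟩ := hs
    exacts [(h p hp).1, (h p hp).2]
  · clear h
    push Not at hs
    induction l with
    | nil => rfl
    | cons p l ih =>
      obtain ⟨hp, hl⟩ := List.forall_mem_cons.1 hs
      exact (congrArg (Equiv.swap p.1 p.2) (ih hl)).trans (Equiv.swap_apply_of_ne_of_ne hp.1 hp.2)

theorem exists_swapProd_eq {σ : Equiv.Perm ℕ} (hσ : (MulAction.fixedBy ℕ σ)ᶜ.Finite) :
    ∃ l, swapProd l = σ := by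
  have hmem : σ ∈ Subgroup.closure {τ : Equiv.Perm ℕ | τ.IsSwap} := mem_closure_isSwap'.2 hσ
  clear hσ
  induction hmem using Subgroup.closure_induction with
  | mem τ hτ =>
    obtain ⟨a, b, -, rfl⟩ := hτ
    exact ⟨[(a, b)], by simp [swapProd]⟩
  | one => exact ⟨[], rfl⟩
  | mul _ _ _ _ hσ hτ =>
    obtain ⟨l, rfl⟩ := hσ
    obtain ⟨m, rfl⟩ := hτ
    exact ⟨l ++ m, swapProd_append l m⟩
  | inv _ _ hσ =>
    obtain ⟨l, rfl⟩ := hσ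
    exact ⟨l.reverse, swapProd_reverse l⟩

/-- The assignment of permutations to letters that is coded by lists of transpositions; letters
beyond the end of the list act trivially. -/
def permOf (A : List (List (ℕ × ℕ))) (i : ℕ) : Equiv.Perm ℕ := swapProd (A.getD i [])

/-- The transpositions whose product is the value of `w` under the assignment coded by `A`. -/
def wordSwaps (A : List (List (ℕ × ℕ))) (w : GWord ℕ) : List (ℕ × ℕ) :=
  w.flatMap fun a => if a.2 then A.getD a.1 [] else (A.getD a.1 []).reverse

theorem swapProd_wordSwaps (A : List (List (ℕ × ℕ))) (w : GWord ℕ) :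
    swapProd (wordSwaps A w) = FreeGroup.lift (permOf A) (FreeGroup.mk w) := by
  induction w with
  | nil => rfl
  | cons a w ih =>
    rw [wordSwaps, List.flatMap_cons, swapProd_append, ← wordSwaps, ih]
    rcases a with ⟨i, _ | _⟩ <;> simp [permOf, swapProd_reverse, FreeGroup.lift_mk]

theorem exists_finitary_action {G : Type*} [Group G] [Group.ResiduallyFinite G] {g : G}
    (hg : g ≠ 1) :
    ∃ ρ : G →* Equiv.Perm ℕ, (∀ h, (MulAction.fixedBy ℕ (ρ h))ᶜ.Finite) ∧ ρ g ≠ 1 := by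
  obtain ⟨N, hN⟩ := Group.exists_finiteIndexNormalSubgroup_notMem g hg
  have : Finite (G ⧸ N.toSubgroup) := inferInstance
  obtain ⟨k, ⟨e⟩⟩ := Finite.exists_equiv_fin (G ⧸ N.toSubgroup)
  let ι : (G ⧸ N.toSubgroup) ↪ ℕ := e.toEmbedding.trans Fin.valEmbedding
  refine ⟨(Equiv.Perm.viaEmbeddingHom ι).comp
    ((MulAction.toPermHom (G ⧸ N.toSubgroup) (G ⧸ N.toSubgroup)).comp
      (QuotientGroup.mk' N.toSubgroup)), fun h => ?_, fun h => ?_⟩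
  · refine (Set.finite_range ι).subset fun s hs => by_contra fun hsι => hs ?_
    exact Equiv.Perm.viaEmbedding_apply_of_notMem _ _ _ hsι
  · have hperm : MulAction.toPermHom (G ⧸ N.toSubgroup) (G ⧸ N.toSubgroup) g = 1 :=
      Equiv.Perm.viaEmbeddingHom_injective ι (h.trans (map_one (Equiv.Perm.viaEmbeddingHom ι)).symm)
    have hone : (g : G ⧸ N.toSubgroup) = 1 :=
      MulAction.toPerm_injective (hperm.trans (map_one (MulAction.toPermHom _ _)).symm)
    exact hN ((QuotientGroup.eq_one_iff g).1 hone)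

section Primrec

open Primrec

theorem primrec_invRev : Primrec (FreeGroup.invRev : GWord ℕ → GWord ℕ) :=
  list_reverse.comp (list_map .id
    (Primrec.pair (fst.comp snd) (Primrec.not.comp (snd.comp snd))).to₂)

theorem primrec_reduce : Primrec (FreeGroup.reduce : GWord ℕ → GWord ℕ) := by
  have hc : PrimrecPred fun q : (GWord ℕ × (ℕ × Bool) × GWord ℕ) × (ℕ × Bool) × GWord ℕ =>
      q.1.2.1.1 = q.2.1.1 ∧ q.1.2.1.2 = !q.2.1.2 :=
    (Primrec.eq.comp (fst.comp (fst.comp (snd.comp fst))) (fst.comp (fst.comp snd))).and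
      (Primrec.eq.comp (snd.comp (fst.comp (snd.comp fst)))
        (Primrec.not.comp (snd.comp (fst.comp snd))))
  have h : Primrec₂ fun (_ : GWord ℕ) (p : (ℕ × Bool) × GWord ℕ) =>
      (List.casesOn p.2 [p.1] fun hd tl =>
        if p.1.1 = hd.1 ∧ p.1.2 = !hd.2 then tl else p.1 :: hd :: tl : GWord ℕ) :=
    list_casesOn (snd.comp snd) (list_cons.comp (fst.comp snd) (.const []))
      (Primrec.ite hc (snd.comp snd) (list_cons.comp (fst.comp (snd.comp fst))
        (list_cons.comp (fst.comp snd) (snd.comp snd)))).to₂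
  refine (list_foldr .id (.const []) h).of_eq fun w => ?_
  induction w with
  | nil => rfl
  | cons a w ih => rw [FreeGroup.reduce.cons, ← ih]; rfl

theorem primrec_relator : Primrec₂ PresentationCode.relator :=
  (option_getD.comp (list_getElem?.comp (snd.comp fst) snd)
    (list_cons.comp (Primrec.pair (nat_add.comp (fst.comp fst)
      (nat_sub.comp snd (list_length.comp (snd.comp fst)))) (.const true)) (.const []))).of_eq
    fun _ => List.getD_eq_getElem?_getD.symm

theorem primrec_conjugate : Primrec₂ PresentationCode.conjugate :=
  have hrel : Primrec fun q : PresentationCode × GWord ℕ × ℕ × Bool => q.1.relator q.2.2.1 :=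
    primrec_relator.comp fst (fst.comp (snd.comp snd))
  list_append.comp (list_append.comp (fst.comp snd)
    (Primrec.ite (Primrec.eq.comp (snd.comp (snd.comp snd)) (.const true)) hrel
      (primrec_invRev.comp hrel))) (primrec_invRev.comp (fst.comp snd))

theorem primrec_swapProd_apply : Primrec₂ fun l s => swapProd l s :=
  (list_foldr fst snd (Primrec.ite (Primrec.eq.comp (snd.comp snd) (fst.comp (fst.comp snd)))
    (snd.comp (fst.comp snd))
    (Primrec.ite (Primrec.eq.comp (snd.comp snd) (snd.comp (fst.comp snd)))
      (fst.comp (fst.comp snd)) (snd.comp snd))).to₂).of_eq fun q => (swapProd_apply q.1 q.2).symm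

theorem primrecPred_swapProd_eq_one : PrimrecPred fun l => swapProd l = 1 := by
  have hfix : PrimrecRel fun (p : ℕ × ℕ) (l : List (ℕ × ℕ)) =>
      swapProd l p.1 = p.1 ∧ swapProd l p.2 = p.2 :=
    (Primrec.eq.comp (primrec_swapProd_apply.comp snd (fst.comp fst)) (fst.comp fst)).and
      (Primrec.eq.comp (primrec_swapProd_apply.comp snd (snd.comp fst)) (snd.comp fst))
  exact (hfix.forall_mem_list.comp .id .id).of_eq fun _ => swapProd_eq_one_iff.symm

theorem primrec_wordSwaps : Primrec₂ wordSwaps :=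
  have hswaps : Primrec fun q : (List (List (ℕ × ℕ)) × GWord ℕ) × ℕ × Bool =>
      q.1.1.getD q.2.1 [] :=
    (list_getD []).comp (fst.comp fst) (fst.comp snd)
  list_flatMap snd (Primrec.ite (Primrec.eq.comp (snd.comp snd) (.const true)) hswaps
    (list_reverse.comp hswaps)).to₂

theorem rePred_mk_mem_relatorSubgroup :
    REPred fun q : PresentationCode × GWord ℕ => FreeGroup.mk q.2 ∈ q.1.relatorSubgroup := by
  have hcert : PrimrecRel fun (q : PresentationCode × GWord ℕ) (L : List (GWord ℕ × ℕ × Bool)) =>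
      FreeGroup.reduce (L.flatMap q.1.conjugate) = FreeGroup.reduce q.2 :=
    Primrec.eq.comp (primrec_reduce.comp (list_flatMap snd
      (primrec_conjugate.comp (fst.comp (fst.comp fst)) snd)))
      (primrec_reduce.comp (snd.comp fst))
  exact (rePred_exists hcert).of_eq fun q => by
    simp only [PresentationCode.mem_relatorSubgroup_iff, ← FreeGroup.toWord_mk,
      FreeGroup.toWord_inj]

theorem rePred_exists_permOf_ne_one :
    REPred fun q : PresentationCode × GWord ℕ => ∃ A : List (List (ℕ × ℕ)), A.length ≤ q.1.1 ∧
      (∀ r ∈ q.1.2, FreeGroup.lift (permOf A) (FreeGroup.mk r) = 1) ∧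
      FreeGroup.lift (permOf A) (FreeGroup.mk q.2) ≠ 1 := by
  simp only [← swapProd_wordSwaps]
  have hrel : PrimrecRel fun (r : GWord ℕ) (A : List (List (ℕ × ℕ))) =>
      swapProd (wordSwaps A r) = 1 :=
    primrecPred_swapProd_eq_one.comp (primrec_wordSwaps.comp snd fst)
  exact rePred_exists ((nat_le.comp (list_length.comp snd) (fst.comp (fst.comp fst))).and
    ((hrel.forall_mem_list.comp (snd.comp (fst.comp fst)) snd).and
      (hrel.comp (snd.comp fst) snd).not))

end Primrec

theorem PresentationCode.notMem_relatorSubgroup_iff {p : PresentationCode}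
    [Group.ResiduallyFinite p.Carrier] {g : FreeGroup ℕ} :
    g ∉ p.relatorSubgroup ↔ ∃ A : List (List (ℕ × ℕ)), A.length ≤ p.1 ∧
      (∀ r ∈ p.2, FreeGroup.lift (permOf A) (FreeGroup.mk r) = 1) ∧
      FreeGroup.lift (permOf A) g ≠ 1 := by
  constructor
  · intro hg
    obtain ⟨ρ, hfin, hρ⟩ := exists_finitary_action (mt (QuotientGroup.eq_one_iff g).1 hg)
    choose l hl using fun h => exists_swapProd_eq (hfin h)
    let A := (List.range p.1).map fun i => l (QuotientGroup.mk (FreeGroup.of i))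
    have hker := PresentationCode.relatorSubgroup_le_iff.1
      (QuotientGroup.ker_mk' p.relatorSubgroup).ge
    have hA : FreeGroup.lift (permOf A) = ρ.comp (QuotientGroup.mk' p.relatorSubgroup) := by
      ext1 i
      rw [FreeGroup.lift_apply_of, permOf]
      by_cases hi : i < p.1
      · simp [A, hi, hl, List.getD_eq_getElem?_getD]
      · rw [List.getD_eq_default _ _ (by simpa [A] using hi), MonoidHom.comp_apply,
          MonoidHom.mem_ker.1 (hker.2 i (not_lt.1 hi)), map_one]
        rfl
    refine ⟨A, by simp [A], fun r hr => ?_, ?_⟩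
    · rw [hA, MonoidHom.comp_apply, MonoidHom.mem_ker.1 (hker.1 r hr), map_one]
    · rwa [hA]
  · rintro ⟨A, hA, hrels, hg⟩ hmem
    refine hg (PresentationCode.relatorSubgroup_le_iff (N := (FreeGroup.lift (permOf A)).ker).2
      ⟨hrels, fun i hi => ?_⟩ hmem)
    rw [MonoidHom.mem_ker, FreeGroup.lift_apply_of, permOf,
      List.getD_eq_default _ _ (hA.trans hi)]
    rfl

theorem decidableOn_mk_mem_relatorSubgroup :
    DecidableOn {q : PresentationCode × GWord ℕ | Group.ResiduallyFinite q.1.Carrier}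
      fun q => FreeGroup.mk q.2 ∈ q.1.relatorSubgroup :=
  .of_rePred rePred_mk_mem_relatorSubgroup rePred_exists_permOf_ne_one fun q hq =>
    have : Group.ResiduallyFinite q.1.Carrier := hq
    PresentationCode.notMem_relatorSubgroup_iff

/-! ### Deciding preservation of group-like elements -/

theorem residuallyFinite_of_injective {G H : Type*} [Group G] [Group H] [Group.ResiduallyFinite H]
    (f : G →* H) (hf : Function.Injective f) : Group.ResiduallyFinite G :=
  Group.residuallyFinite_iff_forall_finiteIndexNormalSubgroup.2 fun g hg =>
    (map_eq_one_iff f hf).1 <| Group.eq_one_iff_forall_finiteIndexNormalSubroup (f g) fun K =>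
      hg (K.comap f)

namespace GWord

section Eval

variable {α β : Type} {G H : Type*} [Group G] [Group H]

theorem eval_append (x : α → G) (v w : GWord α) : eval x (v ++ w) = eval x v * eval x w := by
  rw [eval, ← FreeGroup.mul_mk, map_mul, eval, eval]

theorem eval_invRev (x : α → G) (w : GWord α) : eval x (FreeGroup.invRev w) = (eval x w)⁻¹ := by
  rw [eval, ← FreeGroup.inv_mk, map_inv, eval]

theorem eval_cons (x : α → G) (a : α × Bool) (w : GWord α) :
    eval x (a :: w) = (if a.2 then x a.1 else (x a.1)⁻¹) * eval x w := by
  rw [← List.singleton_append, eval_append]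
  rcases a with ⟨a, _ | _⟩ <;> simp [eval]

theorem eval_rename (x : β → G) (e : α → β) (w : GWord α) :
    eval x (rename e w) = eval (x ∘ e) w := by
  induction w with
  | nil => rfl
  | cons a w ih =>
    exact (eval_cons x _ _).trans ((congrArg _ ih).trans (eval_cons (x ∘ e) _ _).symm)

theorem map_eval (f : G →* H) (x : α → G) (w : GWord α) : f (eval x w) = eval (f ∘ x) w :=
  DFunLike.congr_fun (FreeGroup.ext_hom (f.comp (FreeGroup.lift x)) _ fun a => by simp) _

theorem eval_toWord (x : α → G) [DecidableEq α] (g : FreeGroup α) :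
    eval x g.toWord = FreeGroup.lift x g := by
  rw [eval, FreeGroup.mk_toWord]

/-- Substitute the words listed in `L` for the letters of a word; letters beyond the end of the
list are deleted. -/
def subst (L : List (GWord ℕ)) (w : GWord ℕ) : GWord ℕ :=
  w.flatMap fun a => if a.2 then L.getD a.1 [] else FreeGroup.invRev (L.getD a.1 [])

theorem eval_subst (y : ℕ → G) (L : List (GWord ℕ)) (w : GWord ℕ) :
    eval y (subst L w) = eval (fun i => eval y (L.getD i [])) w := by
  induction w with
  | nil => rfl
  | cons a w ih =>
    rw [subst, List.flatMap_cons, eval_append, ← subst, ih, eval_cons]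
    split_ifs
    · rfl
    · rw [eval_invRev]

end Eval

end GWord

theorem Raag.toAdd_expSum_eval {Γ : Gph.{u}} [DecidableEq Γ.V] {α : Type} (y : α → Γ.V) (v : Γ.V)
    (W : GWord α) : (Raag.expSum v (GWord.eval (fun a => Raag.of (y a)) W)).toAdd =
      (W.countP fun a => y a.1 = v ∧ a.2 : ℤ) - W.countP fun a => y a.1 = v ∧ ¬ a.2 := by
  induction W with
  | nil => exact congrArg Multiplicative.toAdd (map_one _)
  | cons a W ih =>
    rw [GWord.eval_cons, map_mul, toAdd_mul, ih, List.countP_cons, List.countP_cons]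
    rcases a with ⟨a, _ | _⟩ <;> by_cases h : y a = v
    · simp [h, Raag.expSum_of_self]; ring
    · simp [h, Raag.expSum_of_ne h]
    · simp [h, Raag.expSum_of_self]; ring
    · simp [h, Raag.expSum_of_ne h]

/-- A finite description of a coalgebra in the form in which an algorithm reads it: a presentation
of the group, and words for the values of the structure map on the generators. -/
abbrev CoalgebraCode : Type := ℕ × List (GWord ℕ) × List (ACWord ℕ)

namespace CoalgebraCode

/-- The presentation of the underlying group. -/
def presentation (C : CoalgebraCode) : PresentationCode := (C.1, C.2.1)

/-- `u` and `v` represent the same element of the group. -/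
def WordEq (C : CoalgebraCode) (u v : GWord ℕ) : Prop :=
  FreeGroup.mk (u ++ FreeGroup.invRev v) ∈ C.presentation.relatorSubgroup

open Classical in
/-- The criterion by which the algorithm recognises that `u` represents a group-like element `g`:
the exponent sum of `[g]` in some value of the structure map is nonzero. -/
def IsGroupLikeWord (C : CoalgebraCode) (u : GWord ℕ) : Prop :=
  ∃ W ∈ C.2.2, W.countP (fun a => C.WordEq a.1 u ∧ a.2) ≠
    W.countP fun a => C.WordEq a.1 u ∧ ¬ a.2

/-- `C` describes the coalgebra `G`, where the letters stand for the elements `x i`; all but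
finitely many of these are trivial. -/
structure Describes (C : CoalgebraCode) (G : ACCoalgebra.{u}) (x : ℕ → G.A) : Prop where
  surjective : Function.Surjective (FreeGroup.lift x)
  ker_eq : (FreeGroup.lift x).ker = C.presentation.relatorSubgroup
  coact_eq : ∀ i, G.coact (x i) = ACWord.eval x (C.2.2.getD i [])

namespace Describes

variable {C : CoalgebraCode} {G : ACCoalgebra.{u}} {x : ℕ → G.A}

theorem residuallyFinite (h : C.Describes G x) :
    Group.ResiduallyFinite C.presentation.Carrier := by
  obtain ⟨p⟩ := G.nonempty_graphPresentation
  exact residuallyFinite_of_injective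
    ((p.mulEquiv.symm.toMonoidHom.comp (QuotientGroup.kerLift (FreeGroup.lift x))).comp
      (QuotientGroup.quotientMulEquivOfEq h.ker_eq.symm).toMonoidHom)
    ((p.mulEquiv.symm.injective.comp (QuotientGroup.kerLift_injective _)).comp
      (MulEquiv.injective _))

theorem wordEq_iff (h : C.Describes G x) {u v : GWord ℕ} :
    C.WordEq u v ↔ GWord.eval x u = GWord.eval x v := by
  rw [WordEq, ← h.ker_eq, MonoidHom.mem_ker, ← mul_inv_eq_one (b := GWord.eval x v),
    ← GWord.eval_invRev, ← GWord.eval_append, GWord.eval]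

theorem isGroupLikeWord_iff_exists_expSum_ne_one (h : C.Describes G x) {u : GWord ℕ} :
    C.IsGroupLikeWord u ↔ ∃ W ∈ C.2.2, Raag.expSum (Γ := commutationGraph G.A) (GWord.eval x u)
      (ACWord.eval x W) ≠ 1 := by
  classical
  refine exists_congr fun W => and_congr_right fun _ => not_congr ?_
  rw [← toAdd_eq_zero, ACWord.eval, Raag.toAdd_expSum_eval, sub_eq_zero, Nat.cast_inj]
  simp only [h.wordEq_iff]

theorem isGroupLikeWord_iff (h : C.Describes G x) {u : GWord ℕ} :
    C.IsGroupLikeWord u ↔ GWord.eval x u ∈ groupLike G.coact := by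
  rw [h.isGroupLikeWord_iff_exists_expSum_ne_one, G.mem_groupLike_iff h.surjective]
  simp only [h.coact_eq]
  constructor
  · rintro ⟨W, hW, hne⟩
    obtain ⟨i, hi, rfl⟩ := List.getElem_of_mem hW
    exact ⟨i, by rwa [List.getD_eq_getElem _ _ hi]⟩
  · rintro ⟨i, hne⟩
    by_cases hi : i < C.2.2.length
    · rw [List.getD_eq_getElem _ _ hi] at hne
      exact ⟨_, List.getElem_mem hi, hne⟩
    · rw [List.getD_eq_default _ _ (not_lt.1 hi)] at hne
      exact absurd (map_one _) hne

theorem exists_letter_of_mem_groupLike (h : C.Describes G x) {g : G.A}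
    (hg : g ∈ groupLike G.coact) : ∃ a ∈ C.2.2.flatten, GWord.eval x a.1 = g := by
  classical
  obtain ⟨w, rfl⟩ := h.surjective g
  obtain ⟨W, hW, hne⟩ := (h.isGroupLikeWord_iff (u := w.toWord)).2 (by rwa [GWord.eval_toWord])
  by_contra! hall
  have hW0 (a) (ha : a ∈ W) : ¬ C.WordEq a.1 w.toWord := by
    rw [h.wordEq_iff, GWord.eval_toWord]
    exact hall a (List.mem_flatten.2 ⟨W, hW, ha⟩)
  refine hne ((List.countP_eq_zero.2 fun a ha => ?_).trans
    (List.countP_eq_zero.2 fun a ha => ?_).symm) <;> simp [hW0 a ha]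

end Describes

end CoalgebraCode

theorem extend_val_of_le {α : Type*} {n i : ℕ} (hi : n ≤ i) (x : Fin n → α) (e : ℕ → α) :
    Function.extend Fin.val x e i = e i :=
  Function.extend_apply' _ _ _ fun ⟨j, hj⟩ => hi.not_gt (hj ▸ j.2)

theorem forall_extend_getD_ofFn {α β : Type*} {n : ℕ} {x : Fin n → α} {F : Fin n → β} {a : α}
    {b : β} {P : α → β → Prop} (hP : ∀ i, P (x i) (F i)) (h₀ : P a b) (i : ℕ) :
    P (Function.extend Fin.val x (fun _ => a) i) ((List.ofFn F).getD i b) := by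
  obtain hi | hi := lt_or_ge i n
  · lift i to Fin n using hi
    rw [Fin.val_injective.extend_apply, List.getD_eq_getElem _ _ (by simp), List.getElem_ofFn]
    exact hP i
  · rwa [extend_val_of_le hi, List.getD_eq_default _ _ (by simpa using hi)]

section Presents

variable {n : ℕ} {G : Type u} [Group G] {x : Fin n → G}

theorem eval_extend_rename (w : GWord (Fin n)) :
    GWord.eval (Function.extend Fin.val x 1) (GWord.rename Fin.val w) = GWord.eval x w := by
  rw [GWord.eval_rename, Function.extend_comp Fin.val_injective]

theorem eval_extend_rename_rename {G : GrpCat.{u}} {x : Fin n → G} (W : ACWord (Fin n)) :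
    ACWord.eval (Function.extend Fin.val x 1) (GWord.rename (GWord.rename Fin.val) W) =
      ACWord.eval x W := by
  rw [ACWord.eval, GWord.eval_rename, ACWord.eval]
  exact congrArg (GWord.eval · W) (funext fun w => congrArg _ (eval_extend_rename w))

theorem lift_extend_surjective (hx : Function.Surjective (FreeGroup.lift x)) :
    Function.Surjective (FreeGroup.lift (Function.extend Fin.val x 1)) := by
  intro g
  obtain ⟨w, rfl⟩ := hx g
  exact ⟨FreeGroup.mk (GWord.rename Fin.val w.toWord),
    (eval_extend_rename w.toWord).trans (GWord.eval_toWord x w)⟩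

theorem Presents.ker_lift_extend {rels : List (GWord (Fin n))} (hx : Presents x rels) :
    (FreeGroup.lift (Function.extend Fin.val x 1)).ker =
      PresentationCode.relatorSubgroup (n, rels.map (GWord.rename Fin.val)) := by
  set R := PresentationCode.relatorSubgroup (n, rels.map (GWord.rename Fin.val))
  have hR := PresentationCode.relatorSubgroup_le_iff.1 (le_refl R)
  apply le_antisymm
  · let π : FreeGroup ℕ →* FreeGroup (Fin n) := FreeGroup.lift (Function.extend Fin.val .of 1)
    have hπ : FreeGroup.lift (Function.extend Fin.val x 1) = (FreeGroup.lift x).comp π := by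
      ext1 i
      obtain hi | hi := lt_or_ge i n
      · lift i to Fin n using hi
        simp [π, Fin.val_injective.extend_apply]
      · simp [π, extend_val_of_le hi]
    have hmk : ((QuotientGroup.mk' R).comp (FreeGroup.map Fin.val)).comp π =
        QuotientGroup.mk' R := by
      ext1 i
      obtain hi | hi := lt_or_ge i n
      · lift i to Fin n using hi
        simp [π, Fin.val_injective.extend_apply]
      · simpa [π, extend_val_of_le hi] using ((QuotientGroup.eq_one_iff _).2 (hR.2 i hi)).symm
    have hker : (FreeGroup.lift x).ker ≤ R.comap (FreeGroup.map Fin.val) := by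
      rw [hx.2]
      refine Subgroup.normalClosure_le_normal ?_
      rintro _ ⟨r, hr, rfl⟩
      exact hR.1 _ (List.mem_map_of_mem hr)
    intro g hg
    rw [hπ] at hg
    rw [← QuotientGroup.ker_mk' R, ← hmk]
    exact (QuotientGroup.eq_one_iff _).2 (hker hg)
  · refine PresentationCode.relatorSubgroup_le_iff.2 ⟨fun r hr => ?_, fun i hi => ?_⟩
    · obtain ⟨v, hv, rfl⟩ := List.mem_map.1 hr
      have hmem : FreeGroup.mk v ∈ (FreeGroup.lift x).ker :=
        hx.2 ▸ Subgroup.subset_normalClosure ⟨v, hv, rfl⟩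
      exact (eval_extend_rename v).trans hmem
    · rw [MonoidHom.mem_ker, FreeGroup.lift_apply_of, extend_val_of_le hi, Pi.one_apply]

theorem Presents.describes {G : ACCoalgebra.{u}} {x : Fin n → G.A} {rels : List (GWord (Fin n))}
    (hx : Presents x rels) {W : Fin n → ACWord (Fin n)}
    (hW : ∀ i, G.a.hom (x i) = ACWord.eval x (W i)) :
    CoalgebraCode.Describes (n, rels.map (GWord.rename Fin.val),
      List.ofFn fun i => GWord.rename (GWord.rename Fin.val) (W i)) G
      (Function.extend Fin.val x 1) where
  surjective := lift_extend_surjective hx.1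
  ker_eq := hx.ker_lift_extend
  coact_eq := forall_extend_getD_ofFn (a := (1 : G.A))
    (P := fun g V => G.coact g = ACWord.eval (Function.extend Fin.val x 1) V)
    (fun i => (hW i).trans (eval_extend_rename_rename _).symm)
    ((map_one _).trans (map_one _).symm)

end Presents

section Decision

open Primrec

theorem primrec_subst : Primrec₂ GWord.subst := by
  have hletter : Primrec₂ fun (q : List (GWord ℕ) × GWord ℕ) (a : ℕ × Bool) => q.1.getD a.1 [] :=
    (list_getD []).comp (fst.comp fst) (fst.comp snd)
  exact list_flatMap snd (Primrec.ite (Primrec.eq.comp (snd.comp snd) (.const true)) hletter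
    (primrec_invRev.comp hletter)).to₂

theorem decidableOn_wordEq :
    DecidableOn {q : CoalgebraCode × GWord ℕ × GWord ℕ |
      Group.ResiduallyFinite q.1.presentation.Carrier} fun q => q.1.WordEq q.2.1 q.2.2 :=
  decidableOn_mk_mem_relatorSubgroup.comp
    (f := fun q : CoalgebraCode × GWord ℕ × GWord ℕ =>
      (q.1.presentation, q.2.1 ++ FreeGroup.invRev q.2.2))
    (Primrec.pair (Primrec.pair (fst.comp fst) (fst.comp (snd.comp fst)))
      (list_append.comp (fst.comp snd) (primrec_invRev.comp (snd.comp snd)))).to_comp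
    fun _ hq => hq

theorem decidableOn_isGroupLikeWord :
    DecidableOn {q : CoalgebraCode × GWord ℕ | Group.ResiduallyFinite q.1.presentation.Carrier}
      fun q => q.1.IsGroupLikeWord q.2 := by
  classical
  have hletter := decidableOn_wordEq.comp
    (S := {q : ((CoalgebraCode × GWord ℕ) × ACWord ℕ) × GWord ℕ × Bool |
      Group.ResiduallyFinite q.1.1.1.presentation.Carrier})
    (f := fun q => (q.1.1.1, q.2.1, q.1.1.2))
    (Primrec.pair (fst.comp (fst.comp fst)) (Primrec.pair (fst.comp snd)
      (snd.comp (fst.comp fst)))).to_comp fun _ hq => hq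
  have hpos : PrimrecPred fun q : ((CoalgebraCode × GWord ℕ) × ACWord ℕ) × GWord ℕ × Bool =>
      q.2.2 = true := Primrec.eq.comp (snd.comp snd) (.const true)
  exact .exists_mem_list (snd.comp (snd.comp fst)).to_comp <| .ne
    (DecidableOn.computableOn_countP .snd (hletter.and (.of_computablePred hpos.computablePred)))
    (DecidableOn.computableOn_countP .snd
      (hletter.and (.of_computablePred hpos.not.computablePred)))

/-- The criterion by which the algorithm recognises that the homomorphism preserves group-like
elements. -/
def PreservesGroupLikeWords (c : InputCode) : Prop :=
  ∀ a ∈ c.1.2.2.flatten, CoalgebraCode.IsGroupLikeWord c.1 a.1 →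
    CoalgebraCode.IsGroupLikeWord c.2.1 (GWord.subst c.2.2 a.1)

theorem decidableOn_preservesGroupLikeWords :
    DecidableOn {c : InputCode |
      Group.ResiduallyFinite (CoalgebraCode.presentation c.1).Carrier ∧
      Group.ResiduallyFinite (CoalgebraCode.presentation c.2.1).Carrier}
      PreservesGroupLikeWords :=
  .forall_mem_list (list_flatten.comp (snd.comp (snd.comp fst))).to_comp <| .imp
    (decidableOn_isGroupLikeWord.comp
      (Primrec.pair (fst.comp fst) (fst.comp snd)).to_comp fun _ hq => hq.1)
    (decidableOn_isGroupLikeWord.comp (Primrec.pair (fst.comp (snd.comp fst))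
      (primrec_subst.comp (snd.comp (snd.comp fst)) (fst.comp snd))).to_comp fun _ hq => hq.2)

end Decision

section Correctness

variable {G H : ACCoalgebra.{u}} {f : G.A ⟶ H.A}

theorem preservesGroupLikeWords_iff {C D : CoalgebraCode} {M : List (GWord ℕ)} {x : ℕ → G.A}
    {y : ℕ → H.A} (hC : C.Describes G x) (hD : D.Describes H y)
    (hM : ∀ i, f.hom (x i) = GWord.eval y (M.getD i [])) :
    PreservesGroupLikeWords (C, D, M) ↔
      Set.MapsTo f.hom (groupLike G.coact) (groupLike H.coact) := by
  have hsubst (w : GWord ℕ) : GWord.eval y (GWord.subst M w) = f.hom (GWord.eval x w) := by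
    rw [GWord.eval_subst, GWord.map_eval]
    exact congrArg (GWord.eval · w) (funext hM).symm
  simp only [PreservesGroupLikeWords, hC.isGroupLikeWord_iff, hD.isGroupLikeWord_iff, hsubst]
  refine ⟨fun h g hg => ?_, fun h a _ ha => h ha⟩
  obtain ⟨a, ha, rfl⟩ := hC.exists_letter_of_mem_groupLike hg
  exact h a ha hg

theorem InputData.Describes.eval_map {d : InputData} {x : Fin d.n → G.A} {y : Fin d.m → H.A}
    (hd : d.Describes f x y) (i : ℕ) :
    f.hom (Function.extend Fin.val x 1 i) = GWord.eval (Function.extend Fin.val y 1)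
      ((List.ofFn fun i => GWord.rename Fin.val (d.map i)).getD i []) :=
  forall_extend_getD_ofFn (a := (1 : G.A))
    (P := fun g w => f.hom g = GWord.eval (Function.extend Fin.val y 1) w)
    (fun i => (hd.map i).trans (eval_extend_rename _).symm)
    ((map_one f.hom).trans (map_one _).symm) i

end Correctness

/-- One partial recursive function, uniform in all the data, halts on every finite description of
a homomorphism between finitely presented groups with `AC`-coalgebra structures, and answers
whether the homomorphism is `A φ` for a graph homomorphism `φ` of the graphs presenting the two
coalgebras. Such graphs exist, and the answer is right for every choice of them. -/
theorem mainTheorem4 :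
    ∃ alg : InputCode →. Bool, Partrec alg ∧
      ∀ (G H : ACCoalgebra.{u}) (f : G.A ⟶ H.A) (d : InputData)
        (x : Fin d.n → G.A) (y : Fin d.m → H.A), d.Describes f x y →
        Nonempty (GraphPresentation G) ∧ Nonempty (GraphPresentation H) ∧
        ∃ b : Bool, b ∈ alg d.code ∧
          ∀ (p : GraphPresentation G) (q : GraphPresentation H), b = true ↔ IsRaagMap p q f := by
  obtain ⟨b, ⟨alg, halg, hb⟩, hbP⟩ := decidableOn_preservesGroupLikeWords
  refine ⟨alg, halg, fun G H f d x y hd =>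
    ⟨G.nonempty_graphPresentation, H.nonempty_graphPresentation, b d.code, ?_, fun p q => ?_⟩⟩
  all_goals
    have hG := hd.presG.describes hd.coactG
    have hH := hd.presH.describes hd.coactH
    have hres : Group.ResiduallyFinite (CoalgebraCode.presentation d.code.1).Carrier ∧
        Group.ResiduallyFinite (CoalgebraCode.presentation d.code.2.1).Carrier :=
      ⟨hG.residuallyFinite, hH.residuallyFinite⟩
  · exact hb d.code hres
  · rw [hbP d.code hres, isRaagMap_iff_mapsTo_groupLike]
    exact preservesGroupLikeWords_iff hG hH hd.eval_map
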